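/- **Setting.** Let $\mathcal V$ be a category with all small coproducts which is extensive (for every small family $(X_i)_{i\in I}$ of objects the coproduct functor $\prod_i \mathcal V/X_i\to\mathcal V/\coprod_i X_i$ is an equivalence), cartesian closed (with internal hom $[-,-]$, so that $\mathcal V$ is a $\mathcal V$-category) and has pullbacks. Let $\mathcal C$ be a $\mathcal V$-category with a small set of objects. - $\mathrm{Int}\,\mathcal C$ is the category internal to $\mathcal V$ with object of objects $\coprod_{A} 1$ and object of morphisms $\coprod_{A,B}\mathcal C(A,B)$, whose source and target are induced by the indices $A$ and $B$, and whose identities and composition are induced by those of $\mathcal C$. - For a $\mathcal V$-functor $F:\mathcal C^{op}\to\mathcal V$ let $\mathrm{ev}^F_{A,B}:\mathcal C(A,B)\times FB\to FA$ be the transpose of the action of $F$ on hom-objects. The internal category $\int_{\mathcal C}F$ has object of objects $\coprod_A FA$ and object of morphisms $\coprod_{A,B}\mathcal C(A,B)\times FB$; its source is induced by $\mathrm{ev}^F_{A,B}$, its target by the projections to $FB$, its identities and composition by those of $\mathcal C$. The projections $FA\to 1$ and $\mathcal C(A,B)\times FB\to\mathcal C(A,B)$ induce an internal functor $\pi_F:\int_{\mathcal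 C}F\to\mathrm{Int}\,\mathcal C$, and a $\mathcal V$-natural transformation $\alpha:F\Rightarrow G$, with components $\alpha_A:FA\to GA$, induces an internal functor $\int_{\mathcal C}F\to\int_{\mathcal C}G$ over $\mathrm{Int}\,\mathcal C$ given by $\coprod_A\alpha_A$ and $\coprod_{A,B}\mathrm{id}\times\alpha_B$. - An internal functor $P:\mathbb E\to\mathbb B$ is an internal discrete fibration if the square formed by the target maps of $\mathbb E$ and $\mathbb B$ and the two components of $P$ is a pullback in $\mathcal V$. $\mathrm{DFib}(\mathbb B)$ is the full subcategory of the slice $\mathrm{Cat}(\mathcal V)/\mathbb B$ on the internal discrete fibrations. - For internal categories $\mathbb A,\mathbb B$ let $[\![\mathbb A,\mathbb B]\!]_0\in\mathcal V$ be the object of internal functors: maps $X\to[\![\mathbb A,\mathbb B]\!]_0$ correspond, naturally in $X$, to internal functors $\mathbb A\times X\to\mathbb B$, where $X$ is regarded as a discrete internal category. These are the hom-objects of a $\mathcal V$-category of internal categories. The $\mathcal V$-category $\underline{\mathrm{DFib}}(\mathbb B)$ has the internal discrete fibrations over $\mathbb B$ as objects, and its hom-object from $P:\mathbb E\to\mathbb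 B$ to $Q:\mathbb E'\to\mathbb B$ is the fibre over $P:1\to[\![\mathbb E,\mathbb B]\!]_0$ of the map $[\![\mathbb E,\mathbb E']\!]_0\to[\![\mathbb E,\mathbb B]\!]_0$ given by composition with $Q$. - $\mathcal V^{\mathcal C^{op}}$ is the $\mathcal V$-category of $\mathcal V$-functors $\mathcal C^{op}\to\mathcal V$; its hom-object from $F$ to $G$ is the end of $[FA,GA]$, that is, the equalizer of the two canonical maps $\prod_A[FA,GA]\rightrightarrows\prod_{A,B}\bigl[\mathcal C(A,B),[FB,GA]\bigr]$ (the products exist in $\mathcal V$). **Theorem A.** The assignment $F\mapsto(\pi_F:\int_{\mathcal C}F\to\mathrm{Int}\,\mathcal C)$ takes values in internal discrete fibrations, and the resulting functor $$\textstyle\int_{\mathcal C}:\ \mathcal V\text{-}\mathrm{Cat}(\mathcal C^{op},\mathcal V)\longrightarrow\mathrm{DFib}(\mathrm{Int}\,\mathcal C)$$ from the category of $\mathcal V$-functors and $\mathcal V$-natural transformations is an equivalence of categories. Moreover, this functor is the underlying functor of a $\mathcal V$-functor $\mathcal V^{\mathcal C^{op}}\to\underline{\mathrm{DFib}}(\mathrm{Int}\,\mathcal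 C)$ which is an equivalence of $\mathcal V$-categories, that is, has an inverse $\mathcal V$-functor up to $\mathcal V$-natural isomorphism. -/

import Mathlib

open CategoryTheory Limits MonoidalCategory CartesianMonoidalCategory

universe w v u u₁ u₂ u₃ v₁ t

set_option linter.unusedSectionVars false
set_option linter.unnecessarySeqFocus false

noncomputable section

namespace IntGroth

section Extensive

variable {V : Type u} [Category.{v} V] [HasCoproducts.{w} V]

/-- The coproduct functor `∏ i, V / X i ⥤ V / ∐ X`, for a small family `X` of objects. -/
@[simps]
def coprodOver {I : Type w} (X : I → V) : (∀ i, Over (X i)) ⥤ Over (∐ X) where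
  obj Y := Over.mk (Limits.Sigma.map fun i => (Y i).hom)
  map f := Over.homMk (Limits.Sigma.map fun i => (f i).left) (by
    apply Limits.Sigma.hom_ext; intro i; simp)
  map_id Y := by
    ext1; apply Limits.Sigma.hom_ext; intro i; simp
  map_comp f g := by
    ext1; apply Limits.Sigma.hom_ext; intro i; simp

end Extensive

/-- A category with small coproducts is *extensive* if for every small family `X` of objects
the coproduct functor `∏ i, V / X i ⥤ V / ∐ X` is an equivalence. -/
class Extensive (V : Type u) [Category.{v} V] [HasCoproducts.{w} V] : Prop where
  isEquivalence : ∀ {I : Type w} (X : I → V), (coprodOver X).IsEquivalence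

section Extensive

variable {V : Type u} [Category.{v} V] [HasCoproducts.{w} V] [Extensive.{w} V]

/-- Every morphism into a coproduct is, up to isomorphism, a coproduct of morphisms. -/
lemma exists_decomp {I : Type w} (X : I → V) {W : V} (f : W ⟶ ∐ X) :
    ∃ (Y : I → V) (y : ∀ i, Y i ⟶ X i) (e : ∐ Y ≅ W),
      ∀ i, Sigma.ι Y i ≫ e.hom ≫ f = y i ≫ Sigma.ι X i := by
  have := Extensive.isEquivalence X
  let Z := (coprodOver X).objPreimage (Over.mk f)
  let e := (coprodOver X).objObjPreimageIso (Over.mk f)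
  obtain ⟨e', he'⟩ : ∃ e' : ∐ (fun i => (Z i).left) ≅ W,
      e'.hom ≫ f = Limits.Sigma.map fun i => (Z i).hom :=
    ⟨(Over.forget _).mapIso e, Over.w e.hom⟩
  exact ⟨fun i => (Z i).left, fun i => (Z i).hom, e', fun i => by rw [he']; simp⟩

/-- Fullness of the coproduct functor. -/
lemma exists_components {I : Type w} {X : I → V} (A B : ∀ i, Over (X i))
    (z : ∐ (fun i => (A i).left) ⟶ ∐ (fun i => (B i).left))
    (hz : z ≫ Limits.Sigma.map (fun i => (B i).hom) = Limits.Sigma.map (fun i => (A i).hom)) :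
    ∃ η : ∀ i, A i ⟶ B i, Limits.Sigma.map (fun i => (η i).left) = z := by
  have := Extensive.isEquivalence X
  let θ : (coprodOver X).obj A ⟶ (coprodOver X).obj B := Over.homMk z hz
  exact ⟨(coprodOver X).preimage θ,
    congrArg CommaMorphism.left ((coprodOver X).map_preimage θ)⟩

/-- Two morphisms agree if they agree locally with respect to a morphism into a coproduct. -/
lemma ext_of_sigma {I : Type w} {X : I → V} {W Z : V} (f : W ⟶ ∐ X) (a b : W ⟶ Z)
    (h : ∀ (i : I) (T : V) (k : T ⟶ W) (g : T ⟶ X i),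
      k ≫ f = g ≫ Sigma.ι X i → k ≫ a = k ≫ b) : a = b := by
  obtain ⟨Y, y, e, hy⟩ := exists_decomp X f
  rw [← cancel_epi e.hom]
  apply Limits.Sigma.hom_ext
  intro i
  have := h i (Y i) (Sigma.ι Y i ≫ e.hom) (y i) (by simpa using hy i)
  simpa using this

/-- A morphism factors through `φ` if it does so locally. -/
lemma factors_of_local {I : Type w} {X : I → V} {N M W : V} (φ : N ⟶ M) (k : W ⟶ M)
    (f : W ⟶ ∐ X)
    (h : ∀ (i : I) (T : V) (l : T ⟶ W) (g : T ⟶ X i),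
      l ≫ f = g ≫ Sigma.ι X i → ∃ m : T ⟶ N, m ≫ φ = l ≫ k) : ∃ m : W ⟶ N, m ≫ φ = k := by
  obtain ⟨Y, y, e, hy⟩ := exists_decomp X f
  choose m hm using fun i => h i (Y i) (Sigma.ι Y i ≫ e.hom) (y i) (by simpa using hy i)
  refine ⟨e.inv ≫ Limits.Sigma.desc m, ?_⟩
  rw [← cancel_epi e.hom]
  apply Limits.Sigma.hom_ext
  intro i
  have := hm i
  simpa using this

lemma sigma_overlap {I : Type w} {X : I → V} {T : V} {i j : I} (g : T ⟶ X i) (g' : T ⟶ X j)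
    (h : g ≫ Sigma.ι X i = g' ≫ Sigma.ι X j) :
    ∃ m : T ⟶ ∐ fun _ : ULift.{w} (PLift (j = i)) => T,
      m ≫ Limits.Sigma.desc (fun _ => 𝟙 T) = 𝟙 T ∧
      m ≫ Limits.Sigma.desc (fun p => g' ≫ eqToHom (by rw [p.down.down])) = g := by
  let A (l : I) (g : T ⟶ X l) (k : I) : Over (X k) :=
    Over.mk (Y := ∐ fun _ : ULift.{w} (PLift (l = k)) => T)
      (Limits.Sigma.desc fun p => g ≫ eqToHom (by rw [p.down.down]))
  let a : ∐ (fun k => (A i g k).left) ⟶ T :=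
    Limits.Sigma.desc fun k => Limits.Sigma.desc fun _ => 𝟙 T
  let b' : ∐ (fun k => (A j g' k).left) ⟶ T :=
    Limits.Sigma.desc fun k => Limits.Sigma.desc fun _ => 𝟙 T
  let b : T ⟶ ∐ (fun k => (A j g' k).left) :=
    Limits.Sigma.ι (fun _ : ULift.{w} (PLift (j = j)) => T) ⟨⟨rfl⟩⟩ ≫
      Sigma.ι (fun k => (A j g' k).left) j
  have hb : b ≫ b' = 𝟙 T := by simp [b, b', A]
  obtain ⟨η, h1⟩ := exists_components (A i g) (A j g') (a ≫ b) (by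
    apply Limits.Sigma.hom_ext; intro k
    apply Limits.Sigma.hom_ext; intro p
    obtain ⟨⟨rfl⟩⟩ := p
    simp [a, b, A, h])
  let ι₀ : T ⟶ (A i g i).left := Limits.Sigma.ι (fun _ : ULift.{w} (PLift (i = i)) => T) ⟨⟨rfl⟩⟩
  refine ⟨ι₀ ≫ (η i).left, ?_, ?_⟩
  · have h2 : ι₀ ≫ Sigma.ι (fun k => (A i g k).left) i ≫ (a ≫ b) ≫ b' = 𝟙 T := by
      rw [Category.assoc, hb, Category.comp_id]
      simp [a, ι₀]
    rw [← h1] at h2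
    simpa [b', A] using h2
  · have := Over.w (η i)
    have h3 : ι₀ ≫ (η i).left ≫ (A j g' i).hom = ι₀ ≫ (A i g i).hom := by rw [this]
    simpa [ι₀, A] using h3

/-- Coproduct inclusions are monomorphisms. -/
instance mono_ι {I : Type w} (X : I → V) (i : I) : Mono (Sigma.ι X i) where
  right_cancellation {T} g g' h := by
    obtain ⟨m, h1, h2⟩ := sigma_overlap g g' h
    have : Limits.Sigma.desc (fun p : ULift.{w} (PLift (i = i)) =>
        g' ≫ eqToHom (by rw [p.down.down])) = Limits.Sigma.desc (fun _ => 𝟙 T) ≫ g' := by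
      apply Limits.Sigma.hom_ext; intro p; simp
    rw [← h2, this, reassoc_of% h1]

/-- Coproducts are disjoint. -/
lemma eq_of_ne {I : Type w} {X : I → V} {T Z : V} {i j : I} (g : T ⟶ X i) (g' : T ⟶ X j)
    (h : g ≫ Sigma.ι X i = g' ≫ Sigma.ι X j) (hij : i ≠ j) (a b : T ⟶ Z) : a = b := by
  obtain ⟨m, h1, -⟩ := sigma_overlap g g' h
  have : Limits.Sigma.desc (fun _ : ULift.{w} (PLift (j = i)) => 𝟙 T) ≫ a =
      Limits.Sigma.desc (fun _ => 𝟙 T) ≫ b := by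
    apply Limits.Sigma.hom_ext; intro p; exact absurd p.down.down.symm hij
  calc a = m ≫ Limits.Sigma.desc (fun _ => 𝟙 T) ≫ a := by rw [reassoc_of% h1]
    _ = m ≫ Limits.Sigma.desc (fun _ => 𝟙 T) ≫ b := by rw [this]
    _ = b := by rw [reassoc_of% h1]

end Extensive

section Products

variable {V : Type u} [Category.{v} V] [HasCoproducts.{w} V] [Extensive.{w} V]

lemma nonempty_hom_of_ne {I : Type w} {X : I → V} {T : V} {i j : I} (g : T ⟶ X i) (g' : T ⟶ X j)
    (h : g ≫ Sigma.ι X i = g' ≫ Sigma.ι X j) (hij : i ≠ j) (Z : V) : Nonempty (T ⟶ Z) := by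
  obtain ⟨m, -, -⟩ := sigma_overlap g g' h
  exact ⟨m ≫ Limits.Sigma.desc fun p => absurd p.down.down.symm hij⟩

/-- A morphism into `∐ Y` lying over the `i`-th summand of `∐ X` factors through `Y i`. -/
lemma exists_lift_summand {I : Type w} {X Y : I → V} (p : ∀ i, Y i ⟶ X i) {T : V}
    (z : T ⟶ ∐ Y) (i : I) (g : T ⟶ X i)
    (h : z ≫ Limits.Sigma.map p = g ≫ Sigma.ι X i) : ∃ m : T ⟶ Y i, m ≫ Sigma.ι Y i = z := by
  refine factors_of_local (Sigma.ι Y i) z z fun j T' l g' hl => ?_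
  have h' : (g' ≫ p j) ≫ Sigma.ι X j = (l ≫ g) ≫ Sigma.ι X i := by
    rw [Category.assoc, Category.assoc, ← h, reassoc_of% hl]; simp
  by_cases hj : j = i
  · subst hj
    exact ⟨g', hl.symm⟩
  · obtain ⟨m⟩ := nonempty_hom_of_ne _ _ h' hj (Y i)
    exact ⟨m, eq_of_ne _ _ h' hj _ _⟩

variable [CartesianMonoidalCategory V] [BraidedCategory V] [MonoidalClosed V]

lemma tensor_sigma_ext {I : Type w} (X Z : V)
    (a b : (∐ fun _ : I => 𝟙_ V) ⊗ X ⟶ Z)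
    (h : ∀ i, lift (toUnit X ≫ Sigma.ι (fun _ : I => 𝟙_ V) i) (𝟙 X) ≫ a =
      lift (toUnit X ≫ Sigma.ι (fun _ : I => 𝟙_ V) i) (𝟙 X) ≫ b) : a = b := by
  rw [← cancel_epi (β_ _ _).hom]
  apply MonoidalClosed.curry_injective
  apply Limits.Sigma.hom_ext
  intro i
  rw [← MonoidalClosed.curry_natural_left, ← MonoidalClosed.curry_natural_left]
  congr 1
  have e : X ◁ Sigma.ι (fun _ : I => 𝟙_ V) i ≫ (β_ _ _).hom =
      fst _ _ ≫ lift (toUnit X ≫ Sigma.ι (fun _ : I => 𝟙_ V) i) (𝟙 X) := by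
    ext
    · have : snd X (𝟙_ V) = fst X (𝟙_ V) ≫ toUnit X := toUnit_unique _ _
      simp [this]
    · simp [rightUnitor_hom]
  rw [reassoc_of% e, reassoc_of% e, h]

lemma exists_tensor_sigma_desc {I : Type w} (X Z : V) (x : I → (X ⟶ Z)) :
    ∃ a : (∐ fun _ : I => 𝟙_ V) ⊗ X ⟶ Z,
      ∀ i, lift (toUnit X ≫ Sigma.ι (fun _ : I => 𝟙_ V) i) (𝟙 X) ≫ a = x i := by
  refine ⟨(β_ _ _).hom ≫ MonoidalClosed.uncurry
    (Limits.Sigma.desc fun i => MonoidalClosed.curry (fst X (𝟙_ V) ≫ x i)), fun i => ?_⟩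
  have e : lift (toUnit X ≫ Sigma.ι (fun _ : I => 𝟙_ V) i) (𝟙 X) ≫ (β_ _ _).hom =
      lift (𝟙 X) (toUnit X) ≫ X ◁ Sigma.ι (fun _ : I => 𝟙_ V) i := by
    ext <;> simp
  rw [reassoc_of% e, ← MonoidalClosed.uncurry_natural_left, Limits.Sigma.ι_desc,
    MonoidalClosed.uncurry_curry, lift_fst_assoc, Category.id_comp]

variable [HasPullbacks V]

/-- An extensive cartesian closed category with pullbacks has small products. -/
lemma hasProduct_of_extensive {I : Type w} (Y : I → V) : HasProduct Y := by
  let S : I → V := fun _ => 𝟙_ V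
  let p : ∐ Y ⟶ ∐ S := Limits.Sigma.map fun i => toUnit (Y i)
  let n : 𝟙_ V ⟶ (ihom (∐ S)).obj (∐ S) := MonoidalClosed.curry (fst _ _)
  let P := pullback ((ihom (∐ S)).map p) n
  let ev {X : V} (f : X ⟶ (ihom (∐ S)).obj (∐ Y)) (i : I) : X ⟶ ∐ Y :=
    lift (toUnit X ≫ Sigma.ι S i) (𝟙 X) ≫ MonoidalClosed.uncurry f
  have ev_nat {X X' : V} (k : X' ⟶ X) (f : X ⟶ (ihom (∐ S)).obj (∐ Y)) (i : I) :
      ev (k ≫ f) i = k ≫ ev f i := by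
    have : lift (toUnit X' ≫ Sigma.ι S i) (𝟙 X') ≫ _ ◁ k =
        k ≫ lift (toUnit X ≫ Sigma.ι S i) (𝟙 X) := by
      ext <;> simp
    simp only [ev]
    rw [MonoidalClosed.uncurry_natural_left, reassoc_of% this]
  have hp (i : I) : ev (pullback.fst ((ihom (∐ S)).map p) n) i ≫ p = toUnit _ ≫ Sigma.ι S i := by
    simp only [ev, Category.assoc]
    rw [← MonoidalClosed.uncurry_natural_right, pullback.condition,
      MonoidalClosed.uncurry_natural_left, MonoidalClosed.uncurry_curry]
    simp
  choose π hπ using fun i => exists_lift_summand (fun i => toUnit (Y i)) _ i _ (hp i)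
  have hl : ∀ (X : V) (x : ∀ i, X ⟶ Y i), ∃ m : X ⟶ P, ∀ i, m ≫ π i = x i := by
    intro X x
    obtain ⟨a, ha⟩ := exists_tensor_sigma_desc X (∐ Y) (fun i => x i ≫ Sigma.ι Y i)
    have hc : MonoidalClosed.curry a ≫ (ihom (∐ S)).map p = toUnit X ≫ n := by
      rw [← MonoidalClosed.curry_natural_right, ← MonoidalClosed.curry_natural_left]
      congr 1
      apply tensor_sigma_ext
      intro i
      rw [reassoc_of% (ha i)]
      simp [p, S]
    refine ⟨pullback.lift _ _ hc, fun i => ?_⟩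
    rw [← cancel_mono (Sigma.ι Y i), Category.assoc, hπ, ← ev_nat, pullback.lift_fst]
    simp only [ev]
    rw [MonoidalClosed.uncurry_curry, ha]
  have hu : ∀ (X : V) (m m' : X ⟶ P), (∀ i, m ≫ π i = m' ≫ π i) → m = m' := by
    intro X m m' h
    apply pullback.hom_ext
    · apply MonoidalClosed.uncurry_injective
      apply tensor_sigma_ext
      intro i
      have := congrArg (· ≫ Sigma.ι Y i) (h i)
      simp only [Category.assoc, hπ] at this
      rw [← ev_nat, ← ev_nat] at this
      exact this
    · exact toUnit_unique _ _
  choose l hl using hl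
  exact HasLimit.mk ⟨Fan.mk P π, Fan.IsLimit.mk _ (fun s => l s.pt s.proj)
    (fun s j => hl _ _ j) (fun s m hm => hu _ _ _ fun i => (hm i).trans (hl _ _ i).symm)⟩

end Products

section Enriched

variable (V : Type u) [Category.{v} V] [CartesianMonoidalCategory V]

section Elements

variable {V} {C : Type u₁} [EnrichedCategory V C]

/-- Composition of generalized elements of hom-objects: the composite
`X ⟶ C(a, b) × C(b, c) ⟶ C(a, c)`. -/
def eMul {X : V} {a b c : C} (f : X ⟶ (a ⟶[V] b)) (g : X ⟶ (b ⟶[V] c)) : X ⟶ (a ⟶[V] c) :=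
  lift f g ≫ eComp V a b c

lemma comp_eMul {X Y : V} {a b c : C} (k : Y ⟶ X) (f : X ⟶ (a ⟶[V] b)) (g : X ⟶ (b ⟶[V] c)) :
    k ≫ eMul f g = eMul (k ≫ f) (k ≫ g) := by
  simp [eMul, comp_lift_assoc]

lemma eMul_assoc {X : V} {a b c d : C} (f : X ⟶ (a ⟶[V] b)) (g : X ⟶ (b ⟶[V] c))
    (h : X ⟶ (c ⟶[V] d)) : eMul (eMul f g) h = eMul f (eMul g h) := by
  have := congrArg (fun z => lift (lift f g) h ≫ z) (e_assoc' V a b c d)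
  simpa [eMul] using this.symm

lemma unit_eMul {X : V} {a b : C} (f : X ⟶ (a ⟶[V] b)) :
    eMul (toUnit X ≫ eId V a) f = f := by
  have := congrArg (fun z => f ≫ z) (e_id_comp V a b)
  simp only [Category.comp_id] at this
  conv_rhs => rw [← this]
  simp only [eMul, ← Category.assoc]
  congr 1
  ext <;> simp

lemma eMul_unit {X : V} {a b : C} (f : X ⟶ (a ⟶[V] b)) :
    eMul f (toUnit X ≫ eId V b) = f := by
  have := congrArg (fun z => f ≫ z) (e_comp_id V a b)
  simp only [Category.comp_id] at this
  conv_rhs => rw [← this]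
  simp only [eMul, ← Category.assoc]
  congr 1
  ext <;> simp

end Elements

variable (C : Type u₁) [EnrichedCategory V C] (D : Type u₂) [EnrichedCategory V D]

/-- `V`-functors `C ⥤ D`. This is a copy of `EnrichedFunctor`, introduced because the morphisms of
the category structure that `EnrichedFunctor` carries are only natural with respect to the
underlying ordinary categories, whereas we need `V`-natural transformations. -/
structure VFunctor extends EnrichedFunctor V C D

variable {V C D} {E : Type u₃} [EnrichedCategory V E]

namespace VFunctor

variable (V C) in
/-- The identity `V`-functor. -/
def id : VFunctor V C C := ⟨EnrichedFunctor.id V C⟩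

/-- Composition of `V`-functors. -/
def comp (F : VFunctor V C D) (G : VFunctor V D E) : VFunctor V C E :=
  ⟨F.toEnrichedFunctor.comp V G.toEnrichedFunctor⟩

lemma eMul_map (F : VFunctor V C D) {X : V} {a b c : C} (f : X ⟶ (a ⟶[V] b))
    (g : X ⟶ (b ⟶[V] c)) :
    eMul f g ≫ F.map a c = eMul (f ≫ F.map a b) (g ≫ F.map b c) := by
  simp [eMul, F.map_comp]

end VFunctor

/-- A `V`-natural transformation `F ⟶ G` is a family of elements `1 ⟶ D(F A, G A)` such that for
all `A`, `B` the composites `C(A, B) ⟶ D(F A, F B) ⟶ D(F A, G B)` (postcomposition with the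
component at `B`) and `C(A, B) ⟶ D(G A, G B) ⟶ D(F A, G B)` (precomposition with the
component at `A`) agree. -/
@[ext]
structure VNatTrans (F G : VFunctor V C D) where
  /-- The components. -/
  app (A : C) : 𝟙_ V ⟶ (F.obj A ⟶[V] G.obj A)
  naturality (A B : C) :
    eMul (F.map A B) (toUnit _ ≫ app B) = eMul (toUnit _ ≫ app A) (G.map A B)

lemma VNatTrans.naturality' {F G : VFunctor V C D} (α : VNatTrans F G) {A B : C} {X : V}
    (f : X ⟶ (A ⟶[V] B)) :
    eMul (f ≫ F.map A B) (toUnit _ ≫ α.app B) = eMul (toUnit _ ≫ α.app A) (f ≫ G.map A B) := by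
  have := congrArg (f ≫ ·) (α.naturality A B)
  simpa [comp_eMul] using this

/-- The category `V-Cat(C, D)` of `V`-functors and `V`-natural transformations. -/
instance VFunctor.category : Category (VFunctor V C D) where
  Hom F G := VNatTrans F G
  id F :=
    { app A := eId V (F.obj A)
      naturality A B := by rw [eMul_unit, unit_eMul] }
  comp α β :=
    { app A := eMul (α.app A) (β.app A)
      naturality A B := by
        rw [comp_eMul, comp_eMul, ← eMul_assoc, α.naturality, eMul_assoc, β.naturality,
          eMul_assoc] }
  id_comp α := by
    ext A; dsimp only
    simpa using unit_eMul (α.app A)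
  comp_id α := by
    ext A; dsimp only
    simpa using eMul_unit (α.app A)
  assoc α β γ := by
    ext A; exact eMul_assoc _ _ _

@[simp]
lemma VFunctor.id_app (F : VFunctor V C D) (A : C) : VNatTrans.app (𝟙 F) A = eId V (F.obj A) := rfl

@[simp]
lemma VFunctor.comp_app {F G H : VFunctor V C D} (α : F ⟶ G) (β : G ⟶ H) (A : C) :
    VNatTrans.app (α ≫ β) A = eMul (VNatTrans.app α A) (VNatTrans.app β A) := rfl

@[ext]
lemma VFunctor.hom_ext {F G : VFunctor V C D} {α β : F ⟶ G}
    (h : ∀ A, VNatTrans.app α A = VNatTrans.app β A) : α = β :=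
  VNatTrans.ext (funext h)

/-- A `V`-functor is an equivalence of `V`-categories if it has an inverse up to
`V`-natural isomorphism. -/
def VFunctor.IsVEquivalence (F : VFunctor V C D) : Prop :=
  ∃ G : VFunctor V D C, Nonempty (VFunctor.id V C ≅ F.comp G) ∧
    Nonempty (G.comp F ≅ VFunctor.id V D)

/-- Let `C` and `D` be categories enriched over `V`, with given underlying ordinary categories.
A promotion of an ordinary functor `Φ : C ⥤ D` to a `V`-functor: an action of `Φ` on hom-objects
which is `V`-functorial and whose underlying action on morphisms is that of `Φ`. -/
structure Promotion {C : Type u₁} [Category.{v₁} C] [EnrichedOrdinaryCategory V C]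
    {D : Type u₂} [Category.{t} D] [EnrichedOrdinaryCategory V D] (Φ : C ⥤ D) where
  /-- The action on hom-objects. -/
  map (A B : C) : (A ⟶[V] B) ⟶ (Φ.obj A ⟶[V] Φ.obj B)
  map_id (A : C) : eId V A ≫ map A A = eId V (Φ.obj A)
  map_comp (A B C : C) : eComp V A B C ≫ map A C = (map A B ⊗ₘ map B C) ≫ eComp V _ _ _
  map_hom {A B : C} (f : A ⟶ B) : eHomEquiv V f ≫ map A B = eHomEquiv V (Φ.map f)

/-- The `V`-functor given by a promotion of an ordinary functor. -/
def Promotion.toVFunctor {C : Type u₁} [Category.{v₁} C] [EnrichedOrdinaryCategory V C]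
    {D : Type u₂} [Category.{t} D] [EnrichedOrdinaryCategory V D] {Φ : C ⥤ D}
    (P : Promotion (V := V) Φ) : VFunctor V C D where
  obj := Φ.obj
  map := P.map
  map_id := P.map_id
  map_comp := P.map_comp

end Enriched

section Representable

variable (V : Type u) [Category.{v} V] [CartesianMonoidalCategory V]

/-- Parametrized morphisms for a category `K`: for every object `X` of `V` a type `H X a b` of
`X`-parametrized morphisms `a ⟶ b`, which can be reindexed along morphisms `Y ⟶ X` and composed;
the morphisms parametrized by the terminal object are the morphisms of `K`. -/
structure ParamHom (K : Type u₁) [Category.{v₁} K] where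
  /-- `X`-parametrized morphisms. -/
  H : V → K → K → Type t
  /-- Reindexing. -/
  res {X Y : V} {a b : K} : (Y ⟶ X) → H X a b → H Y a b
  /-- Composition. -/
  comp {X : V} {a b c : K} : H X a b → H X b c → H X a c
  /-- The constant parametrized morphism on a morphism of `K`. -/
  const (X : V) {a b : K} : (a ⟶ b) → H X a b
  res_comp {X Y : V} {a b c : K} (k : Y ⟶ X) (f : H X a b) (g : H X b c) :
    res k (comp f g) = comp (res k f) (res k g)
  res_const {X Y : V} {a b : K} (k : Y ⟶ X) (f : a ⟶ b) : res k (const X f) = const Y f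
  id_comp {X : V} {a b : K} (f : H X a b) : comp (const X (𝟙 a)) f = f
  comp_id {X : V} {a b : K} (f : H X a b) : comp f (const X (𝟙 b)) = f
  assoc {X : V} {a b c d : K} (f : H X a b) (g : H X b c) (h : H X c d) :
    comp (comp f g) h = comp f (comp g h)
  const_comp {X : V} {a b c : K} (f : a ⟶ b) (g : b ⟶ c) :
    const X (f ≫ g) = comp (const X f) (const X g)
  const_bijective (a b : K) : Function.Bijective (const (𝟙_ V) : (a ⟶ b) → _)

variable {V} {K : Type u₁} [Category.{v₁} K]

/-- Objects of `V` representing the parametrized morphisms. -/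
structure ParamHom.Rep (P : ParamHom.{v, u, u₁, v₁, t} V K) where
  /-- The representing object. -/
  hom : K → K → V
  /-- Morphisms into the representing object are parametrized morphisms. -/
  equiv {X : V} {a b : K} : (X ⟶ hom a b) ≃ P.H X a b
  natural {X Y : V} {a b : K} (k : Y ⟶ X) (f : X ⟶ hom a b) : equiv (k ≫ f) = P.res k (equiv f)

namespace ParamHom.Rep

variable {P : ParamHom.{v, u, u₁, v₁, t} V K} (R : P.Rep)

/-- Composition of parametrized morphisms, for morphisms into the representing objects. -/
def mul {X : V} {a b c : K} (f : X ⟶ R.hom a b) (g : X ⟶ R.hom b c) : X ⟶ R.hom a c :=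
  R.equiv.symm (P.comp (R.equiv f) (R.equiv g))

lemma comp_mul {X Y : V} {a b c : K} (k : Y ⟶ X) (f : X ⟶ R.hom a b) (g : X ⟶ R.hom b c) :
    k ≫ R.mul f g = R.mul (k ≫ f) (k ≫ g) := by
  apply R.equiv.injective
  simp [mul, R.natural, P.res_comp]

lemma mul_assoc {X : V} {a b c d : K} (f : X ⟶ R.hom a b) (g : X ⟶ R.hom b c)
    (h : X ⟶ R.hom c d) : R.mul (R.mul f g) h = R.mul f (R.mul g h) := by
  simp [mul, P.assoc]

lemma unit_mul {X : V} {a b : K} (k : X ⟶ 𝟙_ V) (f : X ⟶ R.hom a b) :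
    R.mul (k ≫ R.equiv.symm (P.const _ (𝟙 a))) f = f := by
  simp [mul, R.natural, P.res_const, P.id_comp]

lemma mul_unit {X : V} {a b : K} (k : X ⟶ 𝟙_ V) (f : X ⟶ R.hom a b) :
    R.mul f (k ≫ R.equiv.symm (P.const _ (𝟙 b))) = f := by
  simp [mul, R.natural, P.res_const, P.comp_id]

/-- The `V`-category structure on `K` whose hom-objects represent the parametrized morphisms and
whose composition corresponds to the composition of parametrized morphisms. -/
abbrev enriched : EnrichedOrdinaryCategory V K where
  Hom := R.hom
  id a := R.equiv.symm (P.const _ (𝟙 a))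
  comp a b c := R.mul (fst _ _) (snd _ _)
  id_comp a b := by simp [R.comp_mul, R.unit_mul]
  comp_id a b := by simp [R.comp_mul, R.mul_unit]
  assoc a b c d := by simp [R.comp_mul, R.mul_assoc]
  homEquiv := (Equiv.ofBijective _ (P.const_bijective _ _)).trans R.equiv.symm
  homEquiv_id a := rfl
  homEquiv_comp {a b c} f g := by
    have h : ∀ {a b : K} (f : a ⟶ b), ((Equiv.ofBijective _ (P.const_bijective a b)).trans
      R.equiv.symm) f = R.equiv.symm (P.const _ f) := fun f => rfl
    change _ = _ ≫ _ ≫ R.mul (fst _ _) (snd _ _)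
    simp only [h, R.comp_mul]
    simp [mul, P.const_comp]

end ParamHom.Rep

end Representable

section Internal

attribute [local simp] pullback.lift_fst pullback.lift_snd pullback.lift_fst_assoc
  pullback.lift_snd_assoc

/-- A category internal to a category `V` with pullbacks. -/
structure InternalCat (V : Type u) [Category.{v} V] [HasPullbacks V] where
  /-- The object of objects. -/
  obj : V
  /-- The object of morphisms. -/
  mor : V
  /-- The source map. -/
  src : mor ⟶ obj
  /-- The target map. -/
  tgt : mor ⟶ obj
  /-- The identity map. -/
  one : obj ⟶ mor
  /-- The composition map, on pairs `(f, g)` with `tgt f = src g`. -/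
  comp : pullback tgt src ⟶ mor
  one_src : one ≫ src = 𝟙 obj
  one_tgt : one ≫ tgt = 𝟙 obj
  comp_src : comp ≫ src = pullback.fst tgt src ≫ src
  comp_tgt : comp ≫ tgt = pullback.snd tgt src ≫ tgt
  one_comp : pullback.lift (src ≫ one) (𝟙 mor) (by simp [one_tgt]) ≫ comp = 𝟙 mor
  comp_one : pullback.lift (𝟙 mor) (tgt ≫ one) (by simp [one_src]) ≫ comp = 𝟙 mor
  /-- Associativity, for all composable triples of generalized elements `f`, `g`, `h` (equivalently,
  for the universal such triple, with `X` the triple fibre product). -/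
  assoc {X : V} (f g h : X ⟶ mor) (hfg : f ≫ tgt = g ≫ src) (hgh : g ≫ tgt = h ≫ src) :
    pullback.lift (pullback.lift f g hfg ≫ comp) h (by simp [comp_tgt, hgh]) ≫ comp =
      pullback.lift f (pullback.lift g h hgh ≫ comp) (by simp [comp_src, hfg]) ≫ comp

variable {V : Type u} [Category.{v} V] [HasPullbacks V]

namespace InternalCat

attribute [simp] one_src one_tgt comp_src comp_tgt

variable (A : InternalCat V)

@[simp] lemma one_src_assoc {Z : V} (k : A.obj ⟶ Z) : A.one ≫ A.src ≫ k = k := by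
  rw [← Category.assoc, one_src, Category.id_comp]

@[simp] lemma one_tgt_assoc {Z : V} (k : A.obj ⟶ Z) : A.one ≫ A.tgt ≫ k = k := by
  rw [← Category.assoc, one_tgt, Category.id_comp]

@[simp] lemma comp_src_assoc {Z : V} (k : A.obj ⟶ Z) :
    A.comp ≫ A.src ≫ k = pullback.fst A.tgt A.src ≫ A.src ≫ k := by
  rw [← Category.assoc, comp_src, Category.assoc]

@[simp] lemma comp_tgt_assoc {Z : V} (k : A.obj ⟶ Z) :
    A.comp ≫ A.tgt ≫ k = pullback.snd A.tgt A.src ≫ A.tgt ≫ k := by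
  rw [← Category.assoc, comp_tgt, Category.assoc]

/-- Composition of generalized elements. -/
def mul {X : V} (f g : X ⟶ A.mor) (h : f ≫ A.tgt = g ≫ A.src) : X ⟶ A.mor :=
  pullback.lift f g h ≫ A.comp

variable {A}

@[simp]
lemma mul_src {X : V} (f g : X ⟶ A.mor) (h : f ≫ A.tgt = g ≫ A.src) :
    A.mul f g h ≫ A.src = f ≫ A.src := by simp [mul]

@[simp]
lemma mul_tgt {X : V} (f g : X ⟶ A.mor) (h : f ≫ A.tgt = g ≫ A.src) :
    A.mul f g h ≫ A.tgt = g ≫ A.tgt := by simp [mul]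

@[simp]
lemma mul_src_assoc {X Z : V} (f g : X ⟶ A.mor) (h : f ≫ A.tgt = g ≫ A.src) (k : A.obj ⟶ Z) :
    A.mul f g h ≫ A.src ≫ k = f ≫ A.src ≫ k := by simp [mul]

@[simp]
lemma mul_tgt_assoc {X Z : V} (f g : X ⟶ A.mor) (h : f ≫ A.tgt = g ≫ A.src) (k : A.obj ⟶ Z) :
    A.mul f g h ≫ A.tgt ≫ k = g ≫ A.tgt ≫ k := by simp [mul]

lemma comp_mul {X Y : V} (k : Y ⟶ X) (f g : X ⟶ A.mor) (h : f ≫ A.tgt = g ≫ A.src) :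
    k ≫ A.mul f g h = A.mul (k ≫ f) (k ≫ g) (by simp [h]) := by
  simp only [mul, ← Category.assoc]
  congr 1
  ext <;> simp

lemma mul_congr {X : V} {f g f' g' : X ⟶ A.mor} {h : f ≫ A.tgt = g ≫ A.src} (hf : f = f')
    (hg : g = g') : A.mul f g h = A.mul f' g' (by rw [← hf, ← hg, h]) := by
  subst hf hg; rfl

lemma one_mul {X : V} (x : X ⟶ A.obj) (f : X ⟶ A.mor) (h : x = f ≫ A.src) :
    A.mul (x ≫ A.one) f (by simp [h]) = f := by
  subst h
  have := congrArg (f ≫ ·) A.one_comp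
  simp only [Category.comp_id] at this
  conv_rhs => rw [← this]
  simp only [mul, ← Category.assoc]
  congr 1
  ext <;> simp

lemma mul_one {X : V} (x : X ⟶ A.obj) (f : X ⟶ A.mor) (h : f ≫ A.tgt = x) :
    A.mul f (x ≫ A.one) (by simp [h]) = f := by
  subst h
  have := congrArg (f ≫ ·) A.comp_one
  simp only [Category.comp_id] at this
  conv_rhs => rw [← this]
  simp only [mul, ← Category.assoc]
  congr 1
  ext <;> simp

lemma mul_assoc {X : V} (f g h : X ⟶ A.mor) (hfg : f ≫ A.tgt = g ≫ A.src)
    (hgh : g ≫ A.tgt = h ≫ A.src) :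
    A.mul (A.mul f g hfg) h (by simp [hgh]) = A.mul f (A.mul g h hgh) (by simp [hfg]) :=
  A.assoc f g h hfg hgh

lemma mul_fst_snd (A : InternalCat V) :
    A.mul (pullback.fst A.tgt A.src) (pullback.snd A.tgt A.src) pullback.condition = A.comp := by
  have : pullback.lift (pullback.fst A.tgt A.src) (pullback.snd A.tgt A.src) pullback.condition =
      𝟙 _ := by ext <;> simp
  simp [mul, this]

end InternalCat

/-- An internal functor. -/
@[ext]
structure InternalFunctor (A B : InternalCat V) where
  /-- The map on objects of objects. -/
  obj : A.obj ⟶ B.obj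
  /-- The map on objects of morphisms. -/
  mor : A.mor ⟶ B.mor
  src : mor ≫ B.src = A.src ≫ obj
  tgt : mor ≫ B.tgt = A.tgt ≫ obj
  one : A.one ≫ mor = obj ≫ B.one
  comp : A.comp ≫ mor =
    pullback.lift (pullback.fst A.tgt A.src ≫ mor) (pullback.snd A.tgt A.src ≫ mor)
      (by simp only [Category.assoc, src, tgt, pullback.condition_assoc]) ≫ B.comp

namespace InternalFunctor

attribute [simp] src tgt one

variable {A B C : InternalCat V}

@[simp] lemma src_assoc (F : InternalFunctor A B) {Z : V} (k : B.obj ⟶ Z) :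
    F.mor ≫ B.src ≫ k = A.src ≫ F.obj ≫ k := by
  rw [← Category.assoc, src, Category.assoc]

@[simp] lemma tgt_assoc (F : InternalFunctor A B) {Z : V} (k : B.obj ⟶ Z) :
    F.mor ≫ B.tgt ≫ k = A.tgt ≫ F.obj ≫ k := by
  rw [← Category.assoc, tgt, Category.assoc]

@[simp] lemma one_assoc (F : InternalFunctor A B) {Z : V} (k : B.mor ⟶ Z) :
    A.one ≫ F.mor ≫ k = F.obj ≫ B.one ≫ k := by
  rw [← Category.assoc, one, Category.assoc]

lemma mul_mor (F : InternalFunctor A B) {X : V} (f g : X ⟶ A.mor) (h : f ≫ A.tgt = g ≫ A.src) :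
    A.mul f g h ≫ F.mor = B.mul (f ≫ F.mor) (g ≫ F.mor) (by simp [reassoc_of% h]) := by
  simp only [InternalCat.mul, Category.assoc, F.comp]
  simp only [← Category.assoc]
  congr 1
  ext <;> simp

/-- Preservation of composition may be checked on generalized elements. -/
def mk' (obj : A.obj ⟶ B.obj) (mor : A.mor ⟶ B.mor) (src : mor ≫ B.src = A.src ≫ obj)
    (tgt : mor ≫ B.tgt = A.tgt ≫ obj) (one : A.one ≫ mor = obj ≫ B.one)
    (comp : ∀ {X : V} (f g : X ⟶ A.mor) (h : f ≫ A.tgt = g ≫ A.src),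
      A.mul f g h ≫ mor = B.mul (f ≫ mor) (g ≫ mor) (by simp [src, tgt, reassoc_of% h])) :
    InternalFunctor A B where
  obj := obj
  mor := mor
  src := src
  tgt := tgt
  one := one
  comp := by
    rw [← A.mul_fst_snd, comp]; rfl

/-- The category of internal categories and internal functors. -/
instance category : Category (InternalCat V) where
  Hom A B := InternalFunctor A B
  id A := mk' (𝟙 _) (𝟙 _) (by simp) (by simp) (by simp) (by simp)
  comp {A B C} F G := mk' (F.obj ≫ G.obj) (F.mor ≫ G.mor) (by simp) (by simp) (by simp) (by
    intro X f g h
    rw [← Category.assoc, F.mul_mor, G.mul_mor]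
    simp only [Category.assoc])
  id_comp F := by ext <;> simp [mk']
  comp_id F := by ext <;> simp [mk']
  assoc F G H := by ext <;> simp [mk']

@[simp] lemma id_obj (A : InternalCat V) : InternalFunctor.obj (𝟙 A) = 𝟙 A.obj := rfl
@[simp] lemma id_mor (A : InternalCat V) : InternalFunctor.mor (𝟙 A) = 𝟙 A.mor := rfl
@[simp] lemma comp_obj (F : A ⟶ B) (G : B ⟶ C) :
    InternalFunctor.obj (F ≫ G) = InternalFunctor.obj F ≫ InternalFunctor.obj G := rfl
@[simp] lemma comp_mor (F : A ⟶ B) (G : B ⟶ C) :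
    InternalFunctor.mor (F ≫ G) = InternalFunctor.mor F ≫ InternalFunctor.mor G := rfl

@[ext]
lemma hom_ext {F G : A ⟶ B} (h₀ : InternalFunctor.obj F = InternalFunctor.obj G)
    (h₁ : InternalFunctor.mor F = InternalFunctor.mor G) : F = G :=
  InternalFunctor.ext h₀ h₁

end InternalFunctor

/-- An internal functor `P : A ⟶ B` is an internal discrete fibration if the square formed by the
target maps of `A` and `B` and the components of `P` is a pullback. -/
def IsDiscreteFibration {A B : InternalCat V} (P : A ⟶ B) : Prop :=
  IsPullback A.tgt (InternalFunctor.mor P) (InternalFunctor.obj P) B.tgt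

/-- The property of being a discrete fibration, for objects of the slice category over `B`. -/
def discreteFibrations (B : InternalCat V) : ObjectProperty (Over B) :=
  fun P => IsDiscreteFibration P.hom

/-- The category of internal discrete fibrations over `B`, as a full subcategory of the slice. -/
abbrev DFib (B : InternalCat V) := (discreteFibrations B).FullSubcategory

end Internal

section InternalHom

attribute [local simp] pullback.lift_fst pullback.lift_snd pullback.lift_fst_assoc
  pullback.lift_snd_assoc

variable {V : Type u} [Category.{v} V] [CartesianMonoidalCategory V] [HasPullbacks V]

namespace InternalCat

/-- The product in internal categories of `A` with the constant internal category on an object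
`X` of `V` (all of whose structure maps are the identity of `X`). -/
abbrev prodConst (A : InternalCat V) (X : V) : InternalCat V where
  obj := A.obj ⊗ X
  mor := A.mor ⊗ X
  src := A.src ▷ X
  tgt := A.tgt ▷ X
  one := A.one ▷ X
  comp := lift
    (A.mul (pullback.fst _ _ ≫ fst _ _) (pullback.snd _ _ ≫ fst _ _) (by
      have := congrArg (· ≫ fst _ _) (pullback.condition (f := A.tgt ▷ X) (g := A.src ▷ X))
      simpa using this))
    (pullback.fst _ _ ≫ snd _ _)
  one_src := by rw [← comp_whiskerRight]; simp
  one_tgt := by rw [← comp_whiskerRight]; simp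
  comp_src := by ext <;> simp
  comp_tgt := by
    have := congrArg (· ≫ snd _ _) (pullback.condition (f := A.tgt ▷ X) (g := A.src ▷ X))
    ext
    · simp
    · simpa using this
  one_comp := by
    ext
    · simpa [comp_mul] using one_mul (fst A.mor X ≫ A.src) (fst A.mor X) rfl
    · simp
  comp_one := by
    ext
    · simpa [comp_mul] using mul_one (fst A.mor X ≫ A.tgt) (fst A.mor X) rfl
    · simp
  assoc f g h hfg hgh := by
    ext
    · have h₀ := congrArg (· ≫ fst _ _) hfg
      have h₁ := congrArg (· ≫ fst _ _) hgh
      simpa [comp_mul] using mul_assoc (f ≫ fst A.mor X) (g ≫ fst A.mor X) (h ≫ fst A.mor X)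
        (by simpa using h₀) (by simpa using h₁)
    · simp

lemma prodConst_mul (A : InternalCat V) (X : V) {T : V} (f g : T ⟶ A.mor) (x : T ⟶ X)
    (h : f ≫ A.tgt = g ≫ A.src) :
    (A.prodConst X).mul (lift f x) (lift g x) (by simp [h]) =
      lift (A.mul f g h) x := by
  rw [mul]
  ext <;> simp [comp_mul]

lemma prodConst_cases (A : InternalCat V) (X : V) {T : V} (f g : T ⟶ A.mor ⊗ X)
    (h : f ≫ (A.prodConst X).tgt = g ≫ (A.prodConst X).src) :
    ∃ (f' g' : T ⟶ A.mor) (x : T ⟶ X), f' ≫ A.tgt = g' ≫ A.src ∧ f = lift f' x ∧ g = lift g' x := by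
  have h₀ := congrArg (· ≫ fst _ _) h
  have h₁ := congrArg (· ≫ snd _ _) h
  simp only [Category.assoc, whiskerRight_fst, whiskerRight_snd] at h₀ h₁
  exact ⟨f ≫ fst _ _, g ≫ fst _ _, f ≫ snd _ _, by simpa using h₀,
    by ext <;> simp , by ext <;> simp [h₁]⟩

end InternalCat

end InternalHom

section InternalHom

attribute [local simp] pullback.lift_fst pullback.lift_snd pullback.lift_fst_assoc
  pullback.lift_snd_assoc

variable {V : Type u} [Category.{v} V] [CartesianMonoidalCategory V] [HasPullbacks V]

namespace InternalCat

/-- The projection `A × cst X ⟶ A`. -/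
def proj (A : InternalCat V) (X : V) : A.prodConst X ⟶ A :=
  InternalFunctor.mk' (fst _ _) (fst _ _) (by simp) (by simp) (by simp) (by
    intro T f g h
    obtain ⟨f', g', x, h', rfl, rfl⟩ := prodConst_cases A X f g h
    rw [prodConst_mul A X f' g' x h']
    simp)

/-- The internal functor `A × cst Y ⟶ A × cst X` induced by `k : Y ⟶ X`. -/
def reindex (A : InternalCat V) {X Y : V} (k : Y ⟶ X) : A.prodConst Y ⟶ A.prodConst X :=
  InternalFunctor.mk' (_ ◁ k) (_ ◁ k) (by simp [whisker_exchange]) (by simp [whisker_exchange])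
    (by simp [whisker_exchange]) (by
    intro T f g h
    obtain ⟨f', g', x, h', rfl, rfl⟩ := prodConst_cases A Y f g h
    rw [prodConst_mul A Y f' g' x h']
    simp only [lift_whiskerLeft]
    rw [prodConst_mul A X f' g' (x ≫ k) h'])

/-- The internal functor `A × cst X ⟶ B × cst X` with components `F : A × cst X ⟶ B` and the
projection to `cst X`. -/
def graph {A B : InternalCat V} {X : V} (F : A.prodConst X ⟶ B) :
    A.prodConst X ⟶ B.prodConst X :=
  InternalFunctor.mk' (lift (F.obj) (snd _ _)) (lift (F.mor) (snd _ _))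
    (by ext <;> simp) (by ext <;> simp)
    (by ext; · simpa using F.one
        · simp) (by
    intro T f g h
    obtain ⟨f', g', x, h', rfl, rfl⟩ := prodConst_cases A X f g h
    simp only [comp_lift, lift_snd]
    rw [prodConst_mul B X _ _ x (by simp [reassoc_of% h]), InternalFunctor.mul_mor,
      prodConst_mul A X f' g' x h']
    simp)

@[simp] lemma proj_obj (A : InternalCat V) (X : V) : (A.proj X).obj = fst _ _ := rfl
@[simp] lemma proj_mor (A : InternalCat V) (X : V) : (A.proj X).mor = fst _ _ := rfl
@[simp] lemma reindex_obj (A : InternalCat V) {X Y : V} (k : Y ⟶ X) :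
    (A.reindex k).obj = _ ◁ k := rfl
@[simp] lemma reindex_mor (A : InternalCat V) {X Y : V} (k : Y ⟶ X) :
    (A.reindex k).mor = _ ◁ k := rfl
@[simp] lemma graph_obj {A B : InternalCat V} {X : V} (F : A.prodConst X ⟶ B) :
    (graph F).obj = lift (F.obj) (snd _ _) := rfl
@[simp] lemma graph_mor {A B : InternalCat V} {X : V} (F : A.prodConst X ⟶ B) :
    (graph F).mor = lift (F.mor) (snd _ _) := rfl

lemma proj_comp_bijective (A B : InternalCat V) :
    Function.Bijective (fun F : A ⟶ B => A.proj (𝟙_ V) ≫ F) := by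
  let s : A ⟶ A.prodConst (𝟙_ V) := InternalFunctor.mk' (lift (𝟙 _) (toUnit _))
    (lift (𝟙 _) (toUnit _)) (by ext <;> simp) (by ext <;> simp) (by ext <;> simp) (by
      intro T f g h
      have e : ∀ f : T ⟶ A.mor, f ≫ lift (𝟙 _) (toUnit _) = lift f (toUnit T) := by
        intro f; ext <;> simp
      rw [e]
      exact (prodConst_mul A (𝟙_ V) f g (toUnit T) h).symm.trans
        (InternalCat.mul_congr (e f).symm (e g).symm))
  have h₁ : s ≫ A.proj (𝟙_ V) = 𝟙 A := by ext <;> simp [s, InternalFunctor.mk']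
  have h₂ : A.proj (𝟙_ V) ≫ s = 𝟙 _ := by
    apply InternalFunctor.hom_ext
    · apply CartesianMonoidalCategory.hom_ext
      · simp [s, InternalFunctor.mk']
      · exact toUnit_unique _ _
    · apply CartesianMonoidalCategory.hom_ext
      · simp [s, InternalFunctor.mk']
      · exact toUnit_unique _ _
  exact ⟨fun F G h => by simpa [reassoc_of% h₁] using congrArg (s ≫ ·) h,
    fun G => ⟨s ≫ G, by simp [reassoc_of% h₂]⟩⟩

variable (V) in
/-- For an object `X` of `V`, the `X`-parametrized internal functors from `A` to `B` are the
internal functors `A × cst X ⟶ B`. -/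
def paramHom : ParamHom V (InternalCat V) where
  H X A B := A.prodConst X ⟶ B
  res k F := reindex _ k ≫ F
  comp F G := graph F ≫ G
  const := fun X {_ _} F => proj _ X ≫ F
  res_comp k F G := by
    ext <;> simp [← Category.assoc]
  res_const k F := by ext <;> simp
  id_comp F := by ext <;> simp
  comp_id F := by ext <;> simp
  assoc F G H := by ext <;> simp [← Category.assoc]
  const_comp F G := by ext <;> simp
  const_bijective A B := proj_comp_bijective A B

variable [MonoidalClosed V]

section

variable (A B : InternalCat V)

/-- The object of pairs of a map on objects and a map on morphisms, for maps from `A` to `B`. -/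
abbrev homPairs : V := (ihom A.obj).obj B.obj ⊗ (ihom A.mor).obj B.mor

variable {A B} in
/-- The object part of a generalized element of `homPairs`. -/
def objPart {X : V} (f : X ⟶ homPairs A B) : A.obj ⊗ X ⟶ B.obj :=
  MonoidalClosed.uncurry (f ≫ fst _ _)

variable {A B} in
/-- The morphism part of a generalized element of `homPairs`. -/
def morPart {X : V} (f : X ⟶ homPairs A B) : A.mor ⊗ X ⟶ B.mor :=
  MonoidalClosed.uncurry (f ≫ snd _ _)

lemma objPart_comp {X Y : V} (k : Y ⟶ X) (f : X ⟶ homPairs A B) :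
    objPart (k ≫ f) = _ ◁ k ≫ objPart f := by
  simp [objPart, MonoidalClosed.uncurry_natural_left]

lemma morPart_comp {X Y : V} (k : Y ⟶ X) (f : X ⟶ homPairs A B) :
    morPart (k ≫ f) = _ ◁ k ≫ morPart f := by
  simp [morPart, MonoidalClosed.uncurry_natural_left]

instance : HasEqualizers V :=
  hasEqualizers_of_hasPullbacks_and_binary_products

/-- The pairs of maps compatible with sources, targets and identities. -/
def homGraph : V :=
  equalizer (X := homPairs A B)
    (lift (MonoidalClosed.curry (morPart (𝟙 _) ≫ B.src))
      (lift (MonoidalClosed.curry (morPart (𝟙 _) ≫ B.tgt))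
        (MonoidalClosed.curry (A.one ▷ _ ≫ morPart (𝟙 _)))))
    (lift (MonoidalClosed.curry (A.src ▷ _ ≫ objPart (𝟙 _)))
      (lift (MonoidalClosed.curry (A.tgt ▷ _ ≫ objPart (𝟙 _)))
        (MonoidalClosed.curry (objPart (𝟙 _) ≫ B.one))))

/-- The inclusion of `homGraph` in `homPairs`. -/
def homGraphι : homGraph A B ⟶ homPairs A B := equalizer.ι _ _

instance : Mono (homGraphι A B) := equalizer.ι_mono

lemma comp_curry_eq_iff {X P Y Z : V} (f : X ⟶ P) (u v : Y ⊗ P ⟶ Z) :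
    f ≫ MonoidalClosed.curry u = f ≫ MonoidalClosed.curry v ↔ Y ◁ f ≫ u = Y ◁ f ≫ v := by
  rw [← MonoidalClosed.curry_natural_left, ← MonoidalClosed.curry_natural_left]
  exact MonoidalClosed.curry_injective.eq_iff

lemma lift_eq_lift_iff {X Y Z : V} (a a' : X ⟶ Y) (b b' : X ⟶ Z) :
    lift a b = lift a' b' ↔ a = a' ∧ b = b' :=
  ⟨fun h => ⟨by simpa using congrArg (· ≫ fst _ _) h, by simpa using congrArg (· ≫ snd _ _) h⟩,
    fun h => by rw [h.1, h.2]⟩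

lemma exists_equalizer_lift_iff {X Y Z : V} (a b : Y ⟶ Z) [HasEqualizer a b] (f : X ⟶ Y) :
    (∃ g : X ⟶ equalizer a b, g ≫ equalizer.ι a b = f) ↔ f ≫ a = f ≫ b :=
  ⟨by rintro ⟨g, rfl⟩; rw [Category.assoc, equalizer.condition, Category.assoc],
    fun h => ⟨equalizer.lift f h, equalizer.lift_ι _ _⟩⟩

lemma homGraph_iff {X : V} (f : X ⟶ homPairs A B) :
    (∃ g : X ⟶ homGraph A B, g ≫ homGraphι A B = f) ↔
      morPart f ≫ B.src = A.src ▷ _ ≫ objPart f ∧ morPart f ≫ B.tgt = A.tgt ▷ _ ≫ objPart f ∧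
        A.one ▷ _ ≫ morPart f = objPart f ≫ B.one := by
  have e₁ := morPart_comp A B f (𝟙 _)
  have e₀ := objPart_comp A B f (𝟙 _)
  rw [Category.comp_id] at e₀ e₁
  refine (exists_equalizer_lift_iff _ _ f).trans ?_
  rw [comp_lift, comp_lift, comp_lift, comp_lift, lift_eq_lift_iff, lift_eq_lift_iff,
    comp_curry_eq_iff, comp_curry_eq_iff, comp_curry_eq_iff, e₀, e₁]
  simp only [Category.assoc, whisker_exchange_assoc]

lemma homGraphι_spec :
    morPart (homGraphι A B) ≫ B.src = A.src ▷ _ ≫ objPart (homGraphι A B) ∧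
    morPart (homGraphι A B) ≫ B.tgt = A.tgt ▷ _ ≫ objPart (homGraphι A B) ∧
    A.one ▷ _ ≫ morPart (homGraphι A B) = objPart (homGraphι A B) ≫ B.one :=
  (homGraph_iff A B _).1 ⟨𝟙 _, Category.id_comp _⟩

/-- The object `⟦A, B⟧₀` of internal functors from `A` to `B`: the pairs of maps compatible with
sources, targets, identities and composition. -/
def homObj : V :=
  equalizer (X := homGraph A B)
    (MonoidalClosed.curry (A.comp ▷ _ ≫ morPart (homGraphι A B)))
    (MonoidalClosed.curry (pullback.lift
      (pullback.fst A.tgt A.src ▷ _ ≫ morPart (homGraphι A B))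
      (pullback.snd A.tgt A.src ▷ _ ≫ morPart (homGraphι A B)) (by
        rw [Category.assoc, Category.assoc, (homGraphι_spec A B).1, (homGraphι_spec A B).2.1]
        simp only [← comp_whiskerRight_assoc, pullback.condition]) ≫ B.comp))

/-- The inclusion of `⟦A, B⟧₀` in `homGraph`. -/
def homObjToGraph : homObj A B ⟶ homGraph A B := equalizer.ι _ _

instance : Mono (homObjToGraph A B) := equalizer.ι_mono

/-- The inclusion of `⟦A, B⟧₀` in the object of pairs of maps. -/
def homObjι : homObj A B ⟶ homPairs A B := homObjToGraph A B ≫ homGraphι A B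

instance : Mono (homObjι A B) := mono_comp _ _

/-- The condition defining `⟦A, B⟧₀` as a subobject, on generalized elements. -/
lemma equalizer_condition_iff {X : V} (g : X ⟶ homGraph A B) :
    (∃ k : X ⟶ homObj A B, k ≫ homObjToGraph A B = g) ↔
      A.comp ▷ X ≫ morPart (g ≫ homGraphι A B) = pullback.lift
        (pullback.fst A.tgt A.src ▷ X ≫ morPart (g ≫ homGraphι A B))
        (pullback.snd A.tgt A.src ▷ X ≫ morPart (g ≫ homGraphι A B)) (by
          obtain ⟨h₁, h₂, -⟩ := (homGraph_iff A B (g ≫ homGraphι A B)).1 ⟨g, rfl⟩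
          rw [Category.assoc, Category.assoc, h₁, h₂]
          simp only [← comp_whiskerRight_assoc, pullback.condition]) ≫ B.comp := by
  refine (exists_equalizer_lift_iff _ _ g).trans ?_
  rw [comp_curry_eq_iff, whisker_exchange_assoc, ← Category.assoc (_ ◁ g) (pullback.lift _ _ _)]
  rw [← morPart_comp]
  refine Eq.congr_right (congrArg (· ≫ B.comp) ?_)
  apply pullback.hom_ext
  · simp [morPart_comp, whisker_exchange_assoc]
  · simp [morPart_comp, whisker_exchange_assoc]

lemma homObj_iff {X : V} (f : X ⟶ homPairs A B) :
    (∃ g : X ⟶ homObj A B, g ≫ homObjι A B = f) ↔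
      ∃ F : A.prodConst X ⟶ B, F.obj = objPart f ∧ F.mor = morPart f := by
  constructor
  · rintro ⟨k, rfl⟩
    obtain ⟨g, hg⟩ : ∃ g, g = k ≫ homObjToGraph A B := ⟨_, rfl⟩
    have hk : k ≫ homObjι A B = g ≫ homGraphι A B := by rw [hg, homObjι, Category.assoc]
    have hc := (equalizer_condition_iff A B g).1 ⟨k, hg.symm⟩
    rw [hk]
    obtain ⟨h₁, h₂, h₃⟩ := (homGraph_iff A B (g ≫ homGraphι A B)).1 ⟨g, rfl⟩
    refine ⟨InternalFunctor.mk' (objPart (g ≫ homGraphι A B)) (morPart (g ≫ homGraphι A B))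
      h₁ h₂ h₃ ?_, rfl, rfl⟩
    intro T p q h
    obtain ⟨p', q', x, h', rfl, rfl⟩ := prodConst_cases A X p q h
    rw [prodConst_mul A X p' q' x h']
    have := congrArg (lift (pullback.lift p' q' h') x ≫ ·) hc
    simp only [← Category.assoc] at this
    refine (Eq.trans ?_ this).trans ?_
    · rw [mul, lift_whiskerRight]
    · rw [mul]
      congr 1
      apply pullback.hom_ext <;> simp [lift_whiskerRight_assoc]
  · rintro ⟨F, h₀, h₁⟩
    obtain ⟨g, hg⟩ := (homGraph_iff A B f).2
      ⟨by rw [← h₀, ← h₁]; exact F.src, by rw [← h₀, ← h₁]; exact F.tgt,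
        by rw [← h₀, ← h₁]; exact F.one⟩
    obtain ⟨k, hk⟩ := (equalizer_condition_iff A B g).2 (by
      have hF := F.mul_mor (lift (fst _ _ ≫ pullback.fst A.tgt A.src) (snd _ X))
        (lift (fst _ _ ≫ pullback.snd A.tgt A.src) (snd _ X)) (by
          simp [pullback.condition])
      rw [prodConst_mul A X _ _ _ (by simp only [Category.assoc, pullback.condition]),
        ← comp_mul _ _ _ pullback.condition, mul_fst_snd] at hF
      simp only [hg, ← h₁]
      have e : ∀ {P Q : V} (r : P ⟶ Q), r ▷ X = lift (fst _ _ ≫ r) (snd _ X) := by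
        intro P Q r; ext <;> simp
      simp only [e]
      exact hF)
    exact ⟨k, by rw [homObjι, ← Category.assoc, hk, hg]⟩

/-- Morphisms `X ⟶ ⟦A, B⟧₀` are internal functors `A × cst X ⟶ B`. -/
def homObjEquiv {X : V} : (X ⟶ homObj A B) ≃ (A.prodConst X ⟶ B) :=
  Equiv.ofBijective (fun g => ((homObj_iff A B (g ≫ homObjι A B)).1 ⟨g, rfl⟩).choose) (by
    have hs (g : X ⟶ homObj A B) := ((homObj_iff A B (g ≫ homObjι A B)).1 ⟨g, rfl⟩).choose_spec
    constructor
    · intro g g' h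
      dsimp only at h
      have h₀ := hs g
      rw [h, (hs g').1, (hs g').2] at h₀
      rw [← cancel_mono (homObjι A B)]
      apply CartesianMonoidalCategory.hom_ext
      · exact (MonoidalClosed.uncurry_injective h₀.1).symm
      · exact (MonoidalClosed.uncurry_injective h₀.2).symm
    · intro F
      obtain ⟨g, hg⟩ := (homObj_iff A B
        (lift (MonoidalClosed.curry F.obj) (MonoidalClosed.curry F.mor))).2
          ⟨F, by simp [objPart], by simp [morPart]⟩
      refine ⟨g, ?_⟩
      have := hs g
      apply InternalFunctor.hom_ext
      · rw [this.1, hg]; simp [objPart]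
      · rw [this.2, hg]; simp [morPart])

variable {A B}

lemma homObjEquiv_obj {X : V} (g : X ⟶ homObj A B) :
    (homObjEquiv A B g).obj = objPart (g ≫ homObjι A B) :=
  ((homObj_iff A B (g ≫ homObjι A B)).1 ⟨g, rfl⟩).choose_spec.1

lemma homObjEquiv_mor {X : V} (g : X ⟶ homObj A B) :
    (homObjEquiv A B g).mor = morPart (g ≫ homObjι A B) :=
  ((homObj_iff A B (g ≫ homObjι A B)).1 ⟨g, rfl⟩).choose_spec.2

end

variable (V) in
/-- The objects `⟦A, B⟧₀` represent the parametrized internal functors. -/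
def homRep : (paramHom V).Rep where
  hom := homObj
  equiv {X A B} := homObjEquiv A B
  natural {X Y A B} k f := by
    change homObjEquiv A B (k ≫ f) = reindex A k ≫ homObjEquiv A B f
    apply InternalFunctor.hom_ext
    · simp [homObjEquiv_obj, ← objPart_comp]
    · simp [homObjEquiv_mor, ← morPart_comp]

/-- The category of internal categories is enriched over `V`, with hom-objects `⟦A, B⟧₀`. -/
instance : EnrichedOrdinaryCategory V (InternalCat V) := (homRep V).enriched

end InternalCat

end InternalHom

section FunctorCategory

variable {V : Type u} [Category.{v} V] [CartesianMonoidalCategory V]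
variable {C : Type w} [EnrichedCategory V C] {D : Type u₁} [EnrichedCategory V D]

/-- For an object `X` of `V`, the `X`-parametrized `V`-natural transformations from `F` to `G`:
families `X ⟶ D(F A, G A)` such that the two composites `C(A, B) × X ⟶ D(F A, G B)` agree. -/
@[ext]
structure ParamNatTrans (X : V) (F G : VFunctor V C D) where
  /-- The components. -/
  app (A : C) : X ⟶ (F.obj A ⟶[V] G.obj A)
  naturality (A B : C) :
    eMul (fst _ X ≫ F.map A B) (snd _ X ≫ app B) = eMul (snd _ X ≫ app A) (fst _ X ≫ G.map A B)

lemma paramNatTrans_const_iff {X : V} {F G : VFunctor V C D}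
    (app : ∀ A : C, 𝟙_ V ⟶ (F.obj A ⟶[V] G.obj A)) (A B : C)
    (h : eMul (F.map A B) (toUnit _ ≫ app B) = eMul (toUnit _ ≫ app A) (G.map A B)) :
    eMul (fst _ X ≫ F.map A B) (snd _ X ≫ toUnit X ≫ app B) =
      eMul (snd _ X ≫ toUnit X ≫ app A) (fst _ X ≫ G.map A B) := by
  have := congrArg (fst _ X ≫ ·) h
  simpa [comp_eMul] using this

variable (V C D) in
/-- The parametrized `V`-natural transformations, as parametrized morphisms of `V`-functors. -/
def VFunctor.paramHom : ParamHom V (VFunctor V C D) where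
  H := ParamNatTrans
  res {X Y F G} k α :=
    { app A := k ≫ α.app A
      naturality A B := by
        have := congrArg (_ ◁ k ≫ ·) (α.naturality A B)
        simpa [comp_eMul] using this }
  comp α β :=
    { app A := eMul (α.app A) (β.app A)
      naturality A B := by
        rw [comp_eMul, comp_eMul, ← eMul_assoc, α.naturality, eMul_assoc, β.naturality,
          eMul_assoc] }
  const X F G α :=
    { app A := toUnit X ≫ VNatTrans.app α A
      naturality A B := paramNatTrans_const_iff _ A B (VNatTrans.naturality α A B) }
  res_comp k α β := by ext A; exact comp_eMul _ _ _
  res_const k α := by ext A; simp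
  id_comp α := by ext A; exact unit_eMul _
  comp_id α := by ext A; exact eMul_unit _
  assoc α β γ := by ext A; exact eMul_assoc _ _ _
  const_comp α β := by ext A; exact comp_eMul _ _ _
  const_bijective F G := by
    constructor
    · intro α β h
      ext A
      simpa using congrFun (congrArg ParamNatTrans.app h) A
    · intro α
      refine ⟨⟨α.app, fun A B => ?_⟩, by ext A; simp⟩
      have := congrArg (lift (𝟙 _) (toUnit _) ≫ ·) (α.naturality A B)
      simpa [comp_eMul] using this

variable [HasCoproducts.{w} V] [Extensive.{w} V] [BraidedCategory V] [MonoidalClosed V]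
  [HasPullbacks V]

lemma comp_pi_ext {I : Type w} {Y : I → V} [HasProduct Y] {X P : V} (f : X ⟶ P) (a b : P ⟶ ∏ᶜ Y) :
    f ≫ a = f ≫ b ↔ ∀ i, f ≫ a ≫ Pi.π Y i = f ≫ b ≫ Pi.π Y i :=
  ⟨fun h i => by rw [reassoc_of% h], fun h => by
    apply Pi.hom_ext; intro i; simpa using h i⟩

instance hasProduct_instance {I : Type w} (Y : I → V) : HasProduct Y := hasProduct_of_extensive Y

namespace VFunctor

variable (F G : VFunctor V C D)

/-- The object of `V`-natural transformations `F ⟶ G`: the equalizer of the two canonical maps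
from `∏ A, D(F A, G A)` to `∏ A B, [C(A, B), D(F A, G B)]`. -/
def natObj : V :=
  equalizer (X := ∏ᶜ fun A : C => F.obj A ⟶[V] G.obj A)
    (Y := ∏ᶜ fun p : C × C => (ihom (p.1 ⟶[V] p.2)).obj (F.obj p.1 ⟶[V] G.obj p.2))
    (Pi.lift fun p => Pi.π (fun A : C => F.obj A ⟶[V] G.obj A) p.2 ≫
      MonoidalClosed.curry (eMul (fst _ _ ≫ F.map p.1 p.2) (snd _ _)))
    (Pi.lift fun p => Pi.π (fun A : C => F.obj A ⟶[V] G.obj A) p.1 ≫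
      MonoidalClosed.curry (eMul (snd _ _) (fst _ _ ≫ G.map p.1 p.2)))

/-- The inclusion of the object of `V`-natural transformations. -/
def natObjι : natObj F G ⟶ ∏ᶜ fun A : C => F.obj A ⟶[V] G.obj A := equalizer.ι _ _

instance : Mono (natObjι F G) := equalizer.ι_mono

lemma natObj_iff {X : V} (f : X ⟶ ∏ᶜ fun A : C => F.obj A ⟶[V] G.obj A) :
    (∃ g : X ⟶ natObj F G, g ≫ natObjι F G = f) ↔ ∀ A B : C,
      eMul (fst _ X ≫ F.map A B) (snd _ X ≫ f ≫ Pi.π _ B) =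
        eMul (snd _ X ≫ f ≫ Pi.π _ A) (fst _ X ≫ G.map A B) := by
  refine (InternalCat.exists_equalizer_lift_iff _ _ f).trans ?_
  rw [comp_pi_ext, Prod.forall]
  refine forall_congr' fun A => forall_congr' fun B => ?_
  rw [Pi.lift_π, Pi.lift_π, ← Category.assoc, 
    ← MonoidalClosed.curry_natural_left, ← MonoidalClosed.curry_natural_left,
    ← MonoidalClosed.curry_natural_left, MonoidalClosed.curry_injective.eq_iff]
  simp [comp_eMul]

/-- Morphisms `X ⟶ V-Nat(F, G)` are `X`-parametrized `V`-natural transformations. -/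
def natObjEquiv {X : V} : (X ⟶ natObj F G) ≃ ParamNatTrans X F G where
  toFun g :=
    { app A := g ≫ natObjι F G ≫ Pi.π _ A
      naturality A B := by
        simpa using (natObj_iff F G (g ≫ natObjι F G)).1 ⟨g, rfl⟩ A B }
  invFun α := ((natObj_iff F G (Pi.lift α.app)).2 (by simpa using α.naturality)).choose
  left_inv g := by
    have h : Pi.lift (fun A => g ≫ natObjι F G ≫ Pi.π _ A) = g ≫ natObjι F G := by
      apply Pi.hom_ext; intro A; simp
    rw [← cancel_mono (natObjι F G), Exists.choose_spec
      ((natObj_iff F G (Pi.lift fun A => g ≫ natObjι F G ≫ Pi.π _ A)).2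
        ((natObj_iff F G _).1 ⟨g, h.symm⟩)), h]
  right_inv α := by
    ext A
    have := Exists.choose_spec ((natObj_iff F G (Pi.lift α.app)).2 (by simpa using α.naturality))
    dsimp only
    rw [reassoc_of% this, Pi.lift_π]

variable (V C D) in
/-- The objects of `V`-natural transformations represent the parametrized `V`-natural
transformations. -/
def natRep : (paramHom V C D).Rep where
  hom := natObj
  equiv {X F G} := natObjEquiv F G
  natural k f := by
    apply ParamNatTrans.ext
    funext A
    exact Category.assoc _ _ _

/-- The `V`-category of `V`-functors from `C` to `D`. -/
instance : EnrichedOrdinaryCategory V (VFunctor V C D) := (natRep V C D).enriched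

end VFunctor

end FunctorCategory

section Slice

attribute [local simp] pullback.lift_fst pullback.lift_snd pullback.lift_fst_assoc
  pullback.lift_snd_assoc

variable {V : Type u} [Category.{v} V] [CartesianMonoidalCategory V] [HasPullbacks V]
variable {K : Type u₁} [Category.{v₁} K] [EnrichedOrdinaryCategory V K]

namespace OverEnriched

variable {b : K}

/-- The hom-object of the slice category over `b`: the fibre over `P.hom` of the map
`Q.hom ∘ - : K(P.left, Q.left) ⟶ K(P.left, b)`. -/
abbrev hom (P Q : Over b) : V :=
  pullback (eHomWhiskerLeft V P.left Q.hom) (eHomEquiv V P.hom)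

variable (V) in
/-- The inclusion of the hom-object of the slice category. -/
abbrev ι (P Q : Over b) : hom (V := V) P Q ⟶ (P.left ⟶[V] Q.left) := pullback.fst _ _

lemma comp_eHomWhiskerLeft {X : V} {a c d : K} (f : X ⟶ (a ⟶[V] c)) (g : c ⟶ d) :
    f ≫ eHomWhiskerLeft V a g = eMul f (toUnit X ≫ eHomEquiv V g) := by
  rw [eHomWhiskerLeft, eMul]
  simp only [← Category.assoc]
  congr 1
  ext <;> simp

variable {P Q R : Over b}

lemma condition {X : V} (f : X ⟶ hom P Q) :
    eMul (f ≫ ι V P Q) (toUnit X ≫ eHomEquiv V Q.hom) = toUnit X ≫ eHomEquiv V P.hom := by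
  rw [← comp_eHomWhiskerLeft, Category.assoc, pullback.condition, ← Category.assoc]
  congr 1
  exact toUnit_unique _ _

/-- Generalized elements of the hom-object of the slice category. -/
def mk {X : V} (f : X ⟶ (P.left ⟶[V] Q.left))
    (h : eMul f (toUnit X ≫ eHomEquiv V Q.hom) = toUnit X ≫ eHomEquiv V P.hom) : X ⟶ hom P Q :=
  pullback.lift f (toUnit X) (by rw [comp_eHomWhiskerLeft, h])

@[simp] lemma mk_ι {X : V} (f : X ⟶ (P.left ⟶[V] Q.left))
    (h : eMul f (toUnit X ≫ eHomEquiv V Q.hom) = toUnit X ≫ eHomEquiv V P.hom) :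
    mk f h ≫ ι V P Q = f := pullback.lift_fst _ _ _

lemma hom_ext {X : V} {f g : X ⟶ hom P Q} (h : f ≫ ι V P Q = g ≫ ι V P Q) : f = g :=
  pullback.hom_ext h (toUnit_unique _ _)

variable (V P) in
/-- The identity. -/
def one : 𝟙_ V ⟶ hom P P := mk (eId V P.left) (by simpa using unit_eMul (eHomEquiv V P.hom))

/-- The composition, on generalized elements. -/
def mul {X : V} (f : X ⟶ hom P Q) (g : X ⟶ hom Q R) : X ⟶ hom P R :=
  mk (eMul (f ≫ ι V P Q) (g ≫ ι V Q R)) (by rw [eMul_assoc, condition, condition])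

lemma mul_ι {X : V} (f : X ⟶ hom P Q) (g : X ⟶ hom Q R) :
    mul f g ≫ ι V P R = eMul (f ≫ ι V P Q) (g ≫ ι V Q R) := mk_ι _ _

lemma one_ι : one V P ≫ ι V P P = eId V P.left := mk_ι _ _

lemma eHomEquiv_comp' {a c d : K} (f : a ⟶ c) (g : c ⟶ d) :
    eHomEquiv V (f ≫ g) = eMul (eHomEquiv V f) (eHomEquiv V g) := by
  rw [eHomEquiv_comp, eMul, ← Category.assoc]
  congr 1
  apply CartesianMonoidalCategory.hom_ext
  · have : (λ_ (𝟙_ V)).inv ≫ fst _ _ = 𝟙 _ := toUnit_unique _ _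
    rw [Category.assoc, tensorHom_fst, reassoc_of% this, lift_fst]
  · have : (λ_ (𝟙_ V)).inv ≫ snd _ _ = 𝟙 _ := toUnit_unique _ _
    rw [Category.assoc, tensorHom_snd, reassoc_of% this, lift_snd]

lemma comp_mul {X Y : V} (k : Y ⟶ X) (f : X ⟶ hom P Q) (g : X ⟶ hom Q R) :
    k ≫ mul f g = mul (k ≫ f) (k ≫ g) := by
  apply hom_ext
  simp only [Category.assoc, mul_ι, eMul, comp_lift_assoc]

lemma one_mul {X : V} (k : X ⟶ 𝟙_ V) (f : X ⟶ hom P Q) : mul (k ≫ one V P) f = f := by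
  apply hom_ext
  rw [mul_ι, Category.assoc, one_ι, toUnit_unique k (toUnit X), unit_eMul]

lemma mul_one {X : V} (k : X ⟶ 𝟙_ V) (f : X ⟶ hom P Q) : mul f (k ≫ one V Q) = f := by
  apply hom_ext
  rw [mul_ι, Category.assoc, one_ι, toUnit_unique k (toUnit X), eMul_unit]

lemma mul_assoc {S : Over b} {X : V} (f : X ⟶ hom P Q) (g : X ⟶ hom Q R) (h : X ⟶ hom R S) :
    mul (mul f g) h = mul f (mul g h) := by
  apply hom_ext
  rw [mul_ι, mul_ι, mul_ι, mul_ι, eMul_assoc]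

/-- Morphisms in the slice category. -/
def homEquiv : (P ⟶ Q) ≃ (𝟙_ V ⟶ hom P Q) where
  toFun f := mk (eHomEquiv V f.left) (by
    rw [toUnit_unit, Category.id_comp, Category.id_comp, ← eHomEquiv_comp', Over.w])
  invFun g := Over.homMk ((eHomEquiv V).symm (g ≫ ι V P Q)) (by
    apply (eHomEquiv V).injective
    rw [eHomEquiv_comp', Equiv.apply_symm_apply]
    simpa using condition g)
  left_inv f := by ext; simp
  right_inv g := by apply hom_ext; simp

end OverEnriched

open OverEnriched in
/-- The enrichment of the slice category `K / b` induced by an enrichment of `K`: the hom-object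
from `P` to `Q` is the fibre of `K(P.left, Q.left) ⟶ K(P.left, b)` over `P.hom`. -/
instance overEnriched (b : K) : EnrichedOrdinaryCategory V (Over b) where
  Hom := hom
  id P := one V P
  comp P Q R := mul (fst _ _) (snd _ _)
  id_comp P Q := by
    rw [OverEnriched.comp_mul, OverEnriched.comp_mul, whiskerRight_fst, whiskerRight_snd,
      ← Category.assoc, OverEnriched.one_mul, leftUnitor_inv_snd]
  comp_id P Q := by
    rw [OverEnriched.comp_mul, OverEnriched.comp_mul, whiskerLeft_fst, whiskerLeft_snd,
      ← Category.assoc _ _ (one V Q), OverEnriched.mul_one, rightUnitor_inv_fst]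
  assoc P Q R S := by
    simp [OverEnriched.comp_mul, OverEnriched.mul_assoc]
  homEquiv := homEquiv
  homEquiv_id P := OverEnriched.hom_ext (by
    change homEquiv (𝟙 P) ≫ _ = one V P ≫ _
    simp [homEquiv, one_ι])
  homEquiv_comp {P Q R} f g := OverEnriched.hom_ext (by
    change homEquiv (f ≫ g) ≫ _ = (_ ≫ _ ≫ mul (fst _ _) (snd _ _)) ≫ _
    have h₁ : (λ_ (𝟙_ V)).inv ≫ fst _ _ = 𝟙 _ := toUnit_unique _ _
    have h₂ : (λ_ (𝟙_ V)).inv ≫ snd _ _ = 𝟙 _ := toUnit_unique _ _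
    rw [OverEnriched.comp_mul, OverEnriched.comp_mul, tensorHom_fst, tensorHom_snd,
      reassoc_of% h₁, reassoc_of% h₂, mul_ι]
    simp [homEquiv, eHomEquiv_comp'])

end Slice

section Families

attribute [local simp] pullback.lift_fst pullback.lift_snd pullback.lift_fst_assoc
  pullback.lift_snd_assoc

variable {V : Type u} [Category.{v} V] [HasPullbacks V]

variable (V) in
/-- A category internal to families of objects of `V`, with a discrete index set `I` of objects:
objects `X i` of objects and objects `Y i j` of morphisms from `X i` to `X j`. -/
structure FamCat (I : Type w) where
  /-- The objects of objects. -/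
  X (i : I) : V
  /-- The objects of morphisms. -/
  Y (i j : I) : V
  /-- The source maps. -/
  s (i j : I) : Y i j ⟶ X i
  /-- The target maps. -/
  t (i j : I) : Y i j ⟶ X j
  /-- The identity maps. -/
  e (i : I) : X i ⟶ Y i i
  /-- The composition maps. -/
  c (i j k : I) : pullback (t i j) (s j k) ⟶ Y i k
  e_s (i : I) : e i ≫ s i i = 𝟙 _
  e_t (i : I) : e i ≫ t i i = 𝟙 _
  c_s (i j k : I) : c i j k ≫ s i k = pullback.fst _ _ ≫ s i j
  c_t (i j k : I) : c i j k ≫ t i k = pullback.snd _ _ ≫ t j k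
  e_c (i j : I) : pullback.lift (s i j ≫ e i) (𝟙 (Y i j)) (by simp [e_t]) ≫ c i i j = 𝟙 _
  c_e (i j : I) : pullback.lift (𝟙 (Y i j)) (t i j ≫ e j) (by simp [e_s]) ≫ c i j j = 𝟙 _
  assoc {T : V} (i j k l : I) (f : T ⟶ Y i j) (g : T ⟶ Y j k) (h : T ⟶ Y k l)
    (hfg : f ≫ t i j = g ≫ s j k) (hgh : g ≫ t j k = h ≫ s k l) :
    pullback.lift (pullback.lift f g hfg ≫ c i j k) h (by simp [c_t, hgh]) ≫ c i k l =
      pullback.lift f (pullback.lift g h hgh ≫ c j k l) (by simp [c_s, hfg]) ≫ c i j l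

namespace FamCat

variable [HasCoproducts.{w} V] {I : Type w} (D : FamCat V I)

/-- The coproduct of the objects of objects. -/
def obj : V := ∐ D.X

/-- The coproduct of the objects of morphisms. -/
def mor : V := ∐ fun p : I × I => D.Y p.1 p.2

/-- The coproduct of the objects of composable pairs. -/
def pairs : V := ∐ fun p : I × I × I => pullback (D.t p.1 p.2.1) (D.s p.2.1 p.2.2)

/-- Inclusion of a summand. -/
def inObj (i : I) : D.X i ⟶ D.obj := Sigma.ι D.X i

/-- Inclusion of a summand. -/
def inMor (i j : I) : D.Y i j ⟶ D.mor := Sigma.ι (fun p : I × I => D.Y p.1 p.2) (i, j)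

/-- Inclusion of a summand. -/
def inPairs (i j k : I) : pullback (D.t i j) (D.s j k) ⟶ D.pairs :=
  Sigma.ι (fun p : I × I × I => pullback (D.t p.1 p.2.1) (D.s p.2.1 p.2.2)) (i, j, k)

variable {D} {Z : V}

/-- Maps out of the coproduct. -/
def descObj (f : ∀ i, D.X i ⟶ Z) : D.obj ⟶ Z := Limits.Sigma.desc f

/-- Maps out of the coproduct. -/
def descMor (f : ∀ i j, D.Y i j ⟶ Z) : D.mor ⟶ Z := Limits.Sigma.desc fun p => f p.1 p.2

/-- Maps out of the coproduct. -/
def descPairs (f : ∀ i j k, pullback (D.t i j) (D.s j k) ⟶ Z) : D.pairs ⟶ Z :=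
  Limits.Sigma.desc fun p => f p.1 p.2.1 p.2.2

@[simp]
lemma in_descObj (f : ∀ i, D.X i ⟶ Z) (i : I) : D.inObj i ≫ descObj f = f i :=
  Limits.Sigma.ι_desc _ _

@[simp]
lemma in_descObj_assoc {W : V} (f : ∀ i, D.X i ⟶ Z) (i : I) (k : Z ⟶ W) :
    D.inObj i ≫ descObj f ≫ k = f i ≫ k := by
  rw [← Category.assoc, in_descObj]

@[simp]
lemma in_descMor (f : ∀ i j, D.Y i j ⟶ Z) (i j : I) : D.inMor i j ≫ descMor f = f i j :=
  Limits.Sigma.ι_desc (f := fun p : I × I => D.Y p.1 p.2) (fun p => f p.1 p.2) (i, j)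

@[simp]
lemma in_descMor_assoc {W : V} (f : ∀ i j, D.Y i j ⟶ Z) (i j : I) (k : Z ⟶ W) :
    D.inMor i j ≫ descMor f ≫ k = f i j ≫ k := by
  rw [← Category.assoc, in_descMor]

@[simp]
lemma in_descPairs (f : ∀ i j k, pullback (D.t i j) (D.s j k) ⟶ Z) (i j k : I) :
    D.inPairs i j k ≫ descPairs f = f i j k :=
  Limits.Sigma.ι_desc (f := fun p : I × I × I => pullback (D.t p.1 p.2.1) (D.s p.2.1 p.2.2))
    (fun p => f p.1 p.2.1 p.2.2) (i, j, k)

@[simp]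
lemma in_descPairs_assoc {W : V} (f : ∀ i j k, pullback (D.t i j) (D.s j k) ⟶ Z) (i j k : I)
    (g : Z ⟶ W) : D.inPairs i j k ≫ descPairs f ≫ g = f i j k ≫ g := by
  rw [← Category.assoc, in_descPairs]

lemma obj_ext {a b : D.obj ⟶ Z} (h : ∀ i, D.inObj i ≫ a = D.inObj i ≫ b) : a = b :=
  Limits.Sigma.hom_ext _ _ h

lemma mor_ext {a b : D.mor ⟶ Z} (h : ∀ i j, D.inMor i j ≫ a = D.inMor i j ≫ b) : a = b :=
  Limits.Sigma.hom_ext _ _ fun p => h p.1 p.2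

lemma pairs_ext {a b : D.pairs ⟶ Z} (h : ∀ i j k, D.inPairs i j k ≫ a = D.inPairs i j k ≫ b) :
    a = b :=
  Limits.Sigma.hom_ext _ _ fun p => h p.1 p.2.1 p.2.2

variable (D)

/-- The source map. -/
def src : D.mor ⟶ D.obj := descMor fun i j => D.s i j ≫ D.inObj i

/-- The target map. -/
def tgt : D.mor ⟶ D.obj := descMor fun i j => D.t i j ≫ D.inObj j

/-- The identity map. -/
def one : D.obj ⟶ D.mor := descObj fun i => D.e i ≫ D.inMor i i

@[simp]
lemma in_src (i j : I) : D.inMor i j ≫ D.src = D.s i j ≫ D.inObj i := in_descMor _ _ _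

@[simp]
lemma in_src_assoc (i j : I) (k : D.obj ⟶ Z) :
    D.inMor i j ≫ D.src ≫ k = D.s i j ≫ D.inObj i ≫ k := by
  rw [← Category.assoc, in_src, Category.assoc]

@[simp]
lemma in_tgt (i j : I) : D.inMor i j ≫ D.tgt = D.t i j ≫ D.inObj j := in_descMor _ _ _

@[simp]
lemma in_tgt_assoc (i j : I) (k : D.obj ⟶ Z) :
    D.inMor i j ≫ D.tgt ≫ k = D.t i j ≫ D.inObj j ≫ k := by
  rw [← Category.assoc, in_tgt, Category.assoc]

@[simp]
lemma in_one (i : I) : D.inObj i ≫ D.one = D.e i ≫ D.inMor i i := in_descObj _ _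

@[simp]
lemma in_one_assoc (i : I) (k : D.mor ⟶ Z) :
    D.inObj i ≫ D.one ≫ k = D.e i ≫ D.inMor i i ≫ k := by
  rw [← Category.assoc, in_one, Category.assoc]

/-- The canonical comparison from the coproduct of the objects of composable pairs. -/
def pairsMap : D.pairs ⟶ pullback D.tgt D.src :=
  descPairs fun i j k => pullback.lift (pullback.fst _ _ ≫ D.inMor i j)
    (pullback.snd _ _ ≫ D.inMor j k) (by simp [pullback.condition_assoc])

@[simp]
lemma in_pairsMap (i j k : I) : D.inPairs i j k ≫ D.pairsMap =
    pullback.lift (pullback.fst _ _ ≫ D.inMor i j)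
      (pullback.snd _ _ ≫ D.inMor j k) (by simp [pullback.condition_assoc]) :=
  in_descPairs _ _ _ _

@[simp]
lemma in_pairsMap_assoc (i j k : I) (g : pullback D.tgt D.src ⟶ Z) :
    D.inPairs i j k ≫ D.pairsMap ≫ g =
      pullback.lift (pullback.fst _ _ ≫ D.inMor i j)
        (pullback.snd _ _ ≫ D.inMor j k) (by simp [pullback.condition_assoc]) ≫ g := by
  rw [← Category.assoc, in_pairsMap]

variable [Extensive.{w} V]

instance (i : I) : Mono (D.inObj i) := mono_ι _ _

instance (i j : I) : Mono (D.inMor i j) :=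
  mono_ι (fun p : I × I => D.Y p.1 p.2) (i, j)

variable {D}

lemma mor_local {T : V} (f : T ⟶ D.mor) (a b : T ⟶ Z)
    (h : ∀ (i j : I) (S : V) (k : S ⟶ T) (g : S ⟶ D.Y i j), k ≫ f = g ≫ D.inMor i j →
      k ≫ a = k ≫ b) : a = b :=
  ext_of_sigma f a b fun p S k g hk => h p.1 p.2 S k g hk

/-- To compare two maps on a composable pair, one may assume that both components of the pair
lie in summands. -/
lemma pair_local {T : V} (f g : T ⟶ D.mor) (hfg : f ≫ D.tgt = g ≫ D.src) (a b : T ⟶ Z)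
    (h : ∀ (i j l : I) (S : V) (k : S ⟶ T) (f' : S ⟶ D.Y i j) (g' : S ⟶ D.Y j l),
      k ≫ f = f' ≫ D.inMor i j → k ≫ g = g' ≫ D.inMor j l → f' ≫ D.t i j = g' ≫ D.s j l →
      k ≫ a = k ≫ b) : a = b := by
  refine mor_local f a b fun i j S k f' hf => ?_
  refine mor_local (k ≫ g) _ _ fun j' l S' k' g' hg => ?_
  have hk : (k' ≫ f' ≫ D.t i j) ≫ D.inObj j = (g' ≫ D.s j' l) ≫ D.inObj j' := by
    simp only [Category.assoc, ← in_tgt, ← in_src]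
    rw [← reassoc_of% hg, ← reassoc_of% hf, hfg]
  by_cases hj : j = j'
  · subst hj
    have := h i j l S' (k' ≫ k) (k' ≫ f') g' (by simp [hf]) (by simpa using hg)
      (by rw [← cancel_mono (D.inObj j)]; simpa using hk)
    simpa using this
  · exact eq_of_ne _ _ hk hj _ _

lemma mor_eq_of_ne {T : V} {i j i' j' : I} (f : T ⟶ D.Y i j) (g : T ⟶ D.Y i' j')
    (h : f ≫ D.inMor i j = g ≫ D.inMor i' j') (hij : (i, j) ≠ (i', j')) (a b : T ⟶ Z) : a = b :=
  eq_of_ne (X := fun p : I × I => D.Y p.1 p.2) f g h hij a b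

instance : Mono D.pairsMap where
  right_cancellation {T} a b hab := by
    refine ext_of_sigma (X := fun p : I × I × I => pullback (D.t p.1 p.2.1) (D.s p.2.1 p.2.2))
      a a b ?_
    rintro ⟨i, j, l⟩ S k a' ha
    refine ext_of_sigma (X := fun p : I × I × I => pullback (D.t p.1 p.2.1) (D.s p.2.1 p.2.2))
      (k ≫ b) _ _ ?_
    rintro ⟨i', j', l'⟩ S' k' b' hb
    replace ha : k ≫ a = a' ≫ D.inPairs i j l := ha
    replace hb : k' ≫ k ≫ b = b' ≫ D.inPairs i' j' l' := hb
    have h : (k' ≫ a') ≫ D.inPairs i j l ≫ D.pairsMap = b' ≫ D.inPairs i' j' l' ≫ D.pairsMap := by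
      rw [← reassoc_of% hb, Category.assoc, ← reassoc_of% ha, hab]
    have h₁ := congrArg (· ≫ pullback.fst _ _) h
    have h₂ := congrArg (· ≫ pullback.snd _ _) h
    simp only [in_pairsMap, Category.assoc, pullback.lift_fst, pullback.lift_snd] at h₁ h₂
    by_cases h₁' : (i, j) = (i', j')
    · by_cases h₂' : (j, l) = (j', l')
      · obtain ⟨rfl, rfl⟩ := Prod.mk.inj h₁'
        obtain ⟨-, rfl⟩ := Prod.mk.inj h₂'
        rw [ha, hb, ← Category.assoc]
        congr 1
        apply pullback.hom_ext
        · rw [← cancel_mono (D.inMor _ _)]; simpa using h₁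
        · rw [← cancel_mono (D.inMor _ _)]; simpa using h₂
      · exact mor_eq_of_ne (k' ≫ a' ≫ pullback.snd _ _) (b' ≫ pullback.snd _ _)
          (by simpa using h₂) h₂' _ _
    · exact mor_eq_of_ne (k' ≫ a' ≫ pullback.fst _ _) (b' ≫ pullback.fst _ _)
          (by simpa using h₁) h₁' _ _

/-- The comparison is invertible since `V` is extensive. -/
instance : IsIso D.pairsMap := by
  obtain ⟨m, hm⟩ : ∃ m, m ≫ D.pairsMap = 𝟙 _ := by
    refine factors_of_local (X := fun p : I × I => D.Y p.1 p.2) _ _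
      (pullback.fst D.tgt D.src) ?_
    rintro ⟨i, j⟩ S k f hf
    refine factors_of_local (X := fun p : I × I => D.Y p.1 p.2) _ _
      (k ≫ pullback.snd D.tgt D.src) ?_
    rintro ⟨j', l⟩ S' k' g hg
    replace hf : k ≫ pullback.fst _ _ = f ≫ D.inMor i j := hf
    replace hg : k' ≫ k ≫ pullback.snd _ _ = g ≫ D.inMor j' l := hg
    have hk : (k' ≫ f ≫ D.t i j) ≫ D.inObj j = (g ≫ D.s j' l) ≫ D.inObj j' := by
      simp only [Category.assoc, ← in_tgt, ← in_src]
      rw [← reassoc_of% hg, ← reassoc_of% hf, pullback.condition]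
    by_cases hj : j = j'
    · subst hj
      refine ⟨pullback.lift (k' ≫ f) g (by
        rw [← cancel_mono (D.inObj j)]; simpa using hk) ≫ D.inPairs i j l, ?_⟩
      apply pullback.hom_ext
      · simp [hf]
      · simp [hg]
    · obtain ⟨m⟩ := nonempty_hom_of_ne _ _ hk hj D.pairs
      exact ⟨m, eq_of_ne _ _ hk hj _ _⟩
  have : IsSplitEpi D.pairsMap := ⟨⟨⟨m, hm⟩⟩⟩
  exact isIso_of_mono_of_isSplitEpi _

variable (D)

/-- The composition map, defined on the coproduct of the objects of composable pairs. -/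
def comp : pullback D.tgt D.src ⟶ D.mor :=
  inv D.pairsMap ≫ descPairs fun i j k => D.c i j k ≫ D.inMor i k

lemma lift_in_comp {T : V} {i j k : I} (f : T ⟶ D.Y i j) (g : T ⟶ D.Y j k)
    (h : f ≫ D.t i j = g ≫ D.s j k) :
    pullback.lift (f ≫ D.inMor i j) (g ≫ D.inMor j k) (by simp [reassoc_of% h]) ≫ D.comp =
      pullback.lift f g h ≫ D.c i j k ≫ D.inMor i k := by
  have : pullback.lift (f ≫ D.inMor i j) (g ≫ D.inMor j k) (by simp [reassoc_of% h]) =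
      pullback.lift f g h ≫ D.inPairs i j k ≫ D.pairsMap := by
    apply pullback.hom_ext <;> simp
  rw [this, comp, Category.assoc, Category.assoc, IsIso.hom_inv_id_assoc, in_descPairs]

variable {D} in
lemma comp_lift_congr {T S : V} {f g : T ⟶ D.mor} {h : f ≫ D.tgt = g ≫ D.src} (k : S ⟶ T)
    {f' g' : S ⟶ D.mor} (hf : k ≫ f = f') (hg : k ≫ g = g') :
    k ≫ pullback.lift f g h ≫ D.comp =
      pullback.lift f' g' (by rw [← hf, ← hg, Category.assoc, h, Category.assoc]) ≫ D.comp := by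
  subst hf hg
  rw [← Category.assoc]
  congr 1
  apply pullback.hom_ext <;> simp

lemma comp_src : D.comp ≫ D.src = pullback.fst _ _ ≫ D.src := by
  rw [← cancel_epi D.pairsMap]
  apply pairs_ext
  intro i j k
  simp [comp, reassoc_of% (D.c_s i j k)]

lemma comp_tgt : D.comp ≫ D.tgt = pullback.snd _ _ ≫ D.tgt := by
  rw [← cancel_epi D.pairsMap]
  apply pairs_ext
  intro i j k
  simp [comp, reassoc_of% (D.c_t i j k)]

/-- The internal category on the coproducts of the objects of objects and of the objects of
morphisms. -/
abbrev total : InternalCat V where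
  obj := D.obj
  mor := D.mor
  src := D.src
  tgt := D.tgt
  one := D.one
  comp := D.comp
  one_src := by apply obj_ext; intro i; simp [reassoc_of% (D.e_s i)]
  one_tgt := by apply obj_ext; intro i; simp [reassoc_of% (D.e_t i)]
  comp_src := D.comp_src
  comp_tgt := D.comp_tgt
  one_comp := by
    apply mor_ext
    intro i j
    rw [comp_lift_congr _ (f' := (D.s i j ≫ D.e i) ≫ D.inMor i i) (g' := 𝟙 _ ≫ D.inMor i j)
      (by simp) (by simp), lift_in_comp _ _ _ (by simp [D.e_t]), reassoc_of% (D.e_c i j)]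
    simp
  comp_one := by
    apply mor_ext
    intro i j
    rw [comp_lift_congr _ (f' := 𝟙 _ ≫ D.inMor i j) (g' := (D.t i j ≫ D.e j) ≫ D.inMor j j)
      (by simp) (by simp), lift_in_comp _ _ _ (by simp [D.e_s]), reassoc_of% (D.c_e i j)]
    simp
  assoc {T} f g h hfg hgh := by
    refine pair_local f g hfg _ _ fun i j k S x f' g' hf hg hfg' => ?_
    refine pair_local (x ≫ g) (x ≫ h) (by simp [hgh]) _ _ fun j' k' l S' x' g'' h' hg' hh hgh' => ?_
    have hov : (x' ≫ g') ≫ D.inMor j k = g'' ≫ D.inMor j' k' := by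
      rw [Category.assoc, ← hg, hg']
    by_cases hj : (j, k) = (j', k')
    · obtain ⟨rfl, rfl⟩ := Prod.mk.inj hj
      obtain rfl : x' ≫ g' = g'' := by rwa [cancel_mono] at hov
      have hf₁ : (x' ≫ x) ≫ f = (x' ≫ f') ≫ D.inMor i j := by simp [hf]
      have hg₁ : (x' ≫ x) ≫ g = (x' ≫ g') ≫ D.inMor j k := by simp [hg]
      have hh₁ : (x' ≫ x) ≫ h = h' ≫ D.inMor k l := by simpa using hh
      have hfg₁ : (x' ≫ f') ≫ D.t i j = (x' ≫ g') ≫ D.s j k := by simp [hfg']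
      have h₁ := comp_lift_congr (h := hfg) (x' ≫ x) hf₁ hg₁
      have h₂ := comp_lift_congr (h := hgh) (x' ≫ x) hg₁ hh₁
      rw [lift_in_comp _ _ _ hfg₁] at h₁
      rw [lift_in_comp _ _ _ hgh'] at h₂
      rw [← Category.assoc, ← Category.assoc x']
      rw [comp_lift_congr _ (h₁.trans (Category.assoc _ _ _).symm) hh₁,
        comp_lift_congr _ hf₁ (h₂.trans (Category.assoc _ _ _).symm),
        lift_in_comp _ _ _ (by simp [D.c_t, hgh']), lift_in_comp _ _ _ (by simp [D.c_s, hfg']),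
        reassoc_of% (D.assoc i j k l _ _ _ hfg₁ hgh')]
    · exact eq_of_ne (X := fun p : I × I => D.Y p.1 p.2) _ _ hov hj _ _

end FamCat

variable {I : Type w}

/-- Functors of internal categories of families that are the identity on index sets. -/
@[ext]
structure FamFunctor (D E : FamCat V I) where
  /-- The maps on objects of objects. -/
  obj (i : I) : D.X i ⟶ E.X i
  /-- The maps on objects of morphisms. -/
  mor (i j : I) : D.Y i j ⟶ E.Y i j
  src (i j : I) : mor i j ≫ E.s i j = D.s i j ≫ obj i
  tgt (i j : I) : mor i j ≫ E.t i j = D.t i j ≫ obj j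
  one (i : I) : D.e i ≫ mor i i = obj i ≫ E.e i
  comp (i j k : I) : D.c i j k ≫ mor i k =
    pullback.lift (pullback.fst (D.t i j) (D.s j k) ≫ mor i j)
      (pullback.snd (D.t i j) (D.s j k) ≫ mor j k)
      (by simp only [Category.assoc, src, tgt, pullback.condition_assoc]) ≫ E.c i j k

namespace FamFunctor

open FamCat

variable {D E : FamCat V I} [HasCoproducts.{w} V] [Extensive.{w} V]

/-- The internal functor given by the coproducts of the maps on objects of objects and of the maps
on objects of morphisms. -/
def total (F : FamFunctor D E) : D.total ⟶ E.total where
  obj := descObj (D := D) fun i => F.obj i ≫ E.inObj i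
  mor := descMor (D := D) fun i j => F.mor i j ≫ E.inMor i j
  src := by apply mor_ext; intro i j; simp [reassoc_of% (F.src i j)]
  tgt := by apply mor_ext; intro i j; simp [reassoc_of% (F.tgt i j)]
  one := by apply obj_ext; intro i; simp [reassoc_of% (F.one i)]
  comp := by
    rw [← cancel_epi D.pairsMap]
    apply pairs_ext
    intro i j k
    have h₁ : D.inPairs i j k ≫ D.pairsMap ≫ D.comp = D.c i j k ≫ D.inMor i k := by
      simp [FamCat.comp]
    simp only [reassoc_of% h₁, in_descMor, reassoc_of% (F.comp i j k)]
    have h₂ := E.lift_in_comp (pullback.fst (D.t i j) (D.s j k) ≫ F.mor i j)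
      (pullback.snd (D.t i j) (D.s j k) ≫ F.mor j k)
      (by simp only [Category.assoc, F.src, F.tgt, pullback.condition_assoc])
    rw [← h₂]
    simp only [← Category.assoc]
    congr 1
    apply pullback.hom_ext <;> simp

@[simp]
lemma in_total_obj (F : FamFunctor D E) (i : I) :
    D.inObj i ≫ F.total.obj = F.obj i ≫ E.inObj i := in_descObj _ _

@[simp]
lemma in_total_obj_assoc (F : FamFunctor D E) (i : I) {Z : V} (k : E.obj ⟶ Z) :
    D.inObj i ≫ F.total.obj ≫ k = F.obj i ≫ E.inObj i ≫ k := by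
  erw [← Category.assoc, in_total_obj, Category.assoc]

@[simp]
lemma in_total_mor (F : FamFunctor D E) (i j : I) :
    D.inMor i j ≫ F.total.mor = F.mor i j ≫ E.inMor i j :=
  in_descMor (D := D) (Z := E.mor) (fun i j => F.mor i j ≫ E.inMor i j) i j

@[simp]
lemma in_total_mor_assoc (F : FamFunctor D E) (i j : I) {Z : V} (k : E.mor ⟶ Z) :
    D.inMor i j ≫ F.total.mor ≫ k = F.mor i j ≫ E.inMor i j ≫ k := by
  erw [← Category.assoc, in_total_mor, Category.assoc]

lemma total_id (F : FamFunctor D D) (h₀ : ∀ i, F.obj i = 𝟙 _) (h₁ : ∀ i j, F.mor i j = 𝟙 _) :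
    F.total = 𝟙 _ := by
  apply InternalFunctor.hom_ext
  · apply obj_ext; intro i; simp [h₀]
  · apply mor_ext; intro i j; simp [h₁]

lemma total_comp {D' : FamCat V I} (F : FamFunctor D E) (G : FamFunctor E D')
    (H : FamFunctor D D') (h₀ : ∀ i, F.obj i ≫ G.obj i = H.obj i)
    (h₁ : ∀ i j, F.mor i j ≫ G.mor i j = H.mor i j) : F.total ≫ G.total = H.total := by
  apply InternalFunctor.hom_ext
  · apply obj_ext; intro i; simp [← h₀]
  · apply mor_ext; intro i j; simp [← h₁]

end FamFunctor

end Families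

attribute [local instance] MonoidalClosed.enrichedCategorySelf

section Grothendieck

attribute [local simp] pullback.lift_fst pullback.lift_snd pullback.lift_fst_assoc
  pullback.lift_snd_assoc

variable {V : Type u} [Category.{v} V] [CartesianMonoidalCategory V] [MonoidalClosed V]

section Evaluation

variable {X X' P Q R : V}

/-- Evaluation of generalized elements `φ` of `[P, Q]` at generalized elements `x` of `P`. -/
def evalAt (φ : X ⟶ (ihom P).obj Q) (x : X ⟶ P) : X ⟶ Q :=
  lift x (𝟙 X) ≫ MonoidalClosed.uncurry φ

lemma comp_evalAt (k : X' ⟶ X) (φ : X ⟶ (ihom P).obj Q) (x : X ⟶ P) :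
    k ≫ evalAt φ x = evalAt (k ≫ φ) (k ≫ x) := by
  rw [evalAt, evalAt]
  erw [MonoidalClosed.uncurry_natural_left]
  rw [← Category.assoc, ← Category.assoc]
  congr 1
  ext <;> simp

lemma evalAt_unit (x : X ⟶ P) : evalAt (toUnit X ≫ eId V P) x = x := by
  have : MonoidalClosed.uncurry (toUnit X ≫ MonoidalClosed.id P) = fst P X := by
    rw [MonoidalClosed.uncurry_natural_left, MonoidalClosed.id_eq, MonoidalClosed.uncurry_curry]
    simp [rightUnitor_hom]
  rw [evalAt]
  erw [this]
  simp

lemma evalAt_eMul (φ : X ⟶ (ihom P).obj Q) (ψ : X ⟶ (ihom Q).obj R) (x : X ⟶ P) :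
    evalAt (eMul (C := V) (a := P) (b := Q) (c := R) φ ψ) x = evalAt ψ (evalAt φ x) := by
  have : MonoidalClosed.uncurry (lift φ ψ ≫ MonoidalClosed.comp P Q R) =
      lift (MonoidalClosed.uncurry φ) (snd P X) ≫ MonoidalClosed.uncurry ψ := by
    rw [MonoidalClosed.uncurry_natural_left, MonoidalClosed.comp_eq, MonoidalClosed.uncurry_curry,
      MonoidalClosed.compTranspose_eq, MonoidalClosed.uncurry_eq, MonoidalClosed.uncurry_eq]
    have h : P ◁ lift φ ψ ≫ (α_ P ((ihom P).obj Q) ((ihom Q).obj R)).inv ≫ fst _ _ = P ◁ φ := by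
      ext <;> simp
    simp only [← Category.assoc]
    congr 1
    ext
    · simp [reassoc_of% h]
    · simp
  rw [evalAt, evalAt, evalAt]
  erw [this]
  rw [← Category.assoc]
  congr 1
  ext <;> simp

end Evaluation

variable [HasPullbacks V]
variable {C : Type w} [EnrichedCategory V C]

variable (V C) in
/-- The data of the internal category `Int C`: the objects of objects are terminal, and the objects
of morphisms are the hom-objects of `C`. -/
abbrev intFam : FamCat V C where
  X _ := 𝟙_ V
  Y A B := A ⟶[V] B
  s _ _ := toUnit _
  t _ _ := toUnit _
  e A := eId V A
  c _ _ _ := eMul (pullback.fst _ _) (pullback.snd _ _)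
  e_s _ := toUnit_unique _ _
  e_t _ := toUnit_unique _ _
  c_s _ _ _ := toUnit_unique _ _
  c_t _ _ _ := toUnit_unique _ _
  e_c A B := by simpa [comp_eMul] using unit_eMul (𝟙 (A ⟶[V] B))
  c_e A B := by simpa [comp_eMul] using eMul_unit (𝟙 (A ⟶[V] B))
  assoc A B D E f g h hfg hgh := by simp [comp_eMul, eMul_assoc]

variable [BraidedCategory V]

namespace VFunctor

variable (F : VFunctor V Cᵒᵖ V)

/-- The evaluation map `C(A, B) × F B ⟶ F A`, the transpose of the action of `F` on hom-objects. -/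
def ev (A B : C) : (A ⟶[V] B) ⊗ F.obj (.op B) ⟶ F.obj (.op A) :=
  lift (snd _ _) (fst _ _) ≫ MonoidalClosed.uncurry (F.map (.op B) (.op A))

lemma lift_ev {X : V} {A B : C} (f : X ⟶ (A ⟶[V] B)) (x : X ⟶ F.obj (.op B)) :
    lift f x ≫ F.ev A B = evalAt (f ≫ F.map (.op B) (.op A)) x := by
  rw [ev, evalAt]
  erw [MonoidalClosed.uncurry_natural_left]
  simp only [← Category.assoc]
  congr 1
  ext <;> simp

lemma ev_id {X : V} {A : C} (x : X ⟶ F.obj (.op A)) :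
    lift (toUnit X ≫ eId V A) x ≫ F.ev A A = x := by
  rw [lift_ev]
  have := F.map_id (.op A)
  rw [Category.assoc]
  erw [this]
  exact evalAt_unit x

lemma lift_braiding {X Y Z : V} (f : X ⟶ Y) (g : X ⟶ Z) : lift g f ≫ (β_ Z Y).hom = lift f g := by
  ext <;> simp

lemma eMul_op {X : V} {A B D : C} (f : X ⟶ (A ⟶[V] B)) (g : X ⟶ (B ⟶[V] D)) :
    eMul (C := Cᵒᵖ) (a := .op D) (b := .op B) (c := .op A) g f = eMul f g := by
  rw [eMul, eMul, eComp_op_eq, ← Category.assoc]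
  exact congrArg (· ≫ eComp V A B D) (lift_braiding f g)

lemma ev_comp {X : V} {A B D : C} (f : X ⟶ (A ⟶[V] B)) (g : X ⟶ (B ⟶[V] D))
    (x : X ⟶ F.obj (.op D)) :
    lift (eMul f g) x ≫ F.ev A D = lift f (lift g x ≫ F.ev B D) ≫ F.ev A B := by
  rw [lift_ev, lift_ev, lift_ev, ← evalAt_eMul, ← eMul_op]
  congr 1
  exact F.eMul_map (a := .op D) (b := .op B) (c := .op A) g f

/-- The data of the internal category `∫ F`. -/
abbrev elemFam : FamCat V C where
  X A := F.obj (.op A)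
  Y A B := (A ⟶[V] B) ⊗ F.obj (.op B)
  s A B := F.ev A B
  t A B := snd _ _
  e A := lift (toUnit _ ≫ eId V A) (𝟙 _)
  c A B D := lift (eMul (pullback.fst _ _ ≫ fst _ _) (pullback.snd _ _ ≫ fst _ _))
    (pullback.snd _ _ ≫ snd _ _)
  e_s A := F.ev_id _
  e_t A := by simp
  c_s A B D := by
    have h : pullback.fst (snd _ _) (F.ev B D) ≫ snd (A ⟶[V] B) _ = _ := pullback.condition
    rw [ev_comp]
    have e : ∀ {X Y Z : V} (k : X ⟶ Y ⊗ Z), lift (k ≫ fst _ _) (k ≫ snd _ _) = k := by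
      intro X Y Z k; ext <;> simp
    rw [e, ← h, e]
  c_t A B D := by simp
  e_c A B := by
    ext
    · simpa [comp_eMul] using unit_eMul (fst (A ⟶[V] B) (F.obj (.op B)))
    · simp
  c_e A B := by
    ext
    · simpa [comp_eMul] using eMul_unit (fst (A ⟶[V] B) (F.obj (.op B)))
    · simp
  assoc A B D E f g h hfg hgh := by
    ext <;> simp [comp_eMul, eMul_assoc]

/-- The data of the projection `∫ F ⟶ Int C`. -/
def projFam : FamFunctor F.elemFam (intFam V C) where
  obj A := toUnit _
  mor A B := fst _ _
  src A B := toUnit_unique _ _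
  tgt A B := toUnit_unique _ _
  one A := by simp
  comp A B D := by simp [comp_eMul]

variable {F} {G H : VFunctor V Cᵒᵖ V}

/-- The component `F A ⟶ G A` of a `V`-natural transformation. -/
def evNat (α : F ⟶ G) (A : C) : F.obj (.op A) ⟶ G.obj (.op A) :=
  MonoidalClosed.uncurry' (VNatTrans.app α (.op A))

lemma comp_evNat (α : F ⟶ G) (A : C) {X : V} (x : X ⟶ F.obj (.op A)) :
    x ≫ evNat α A = evalAt (toUnit X ≫ VNatTrans.app α (.op A)) x := by
  rw [evNat, evalAt, MonoidalClosed.uncurry']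
  erw [MonoidalClosed.uncurry_natural_left]
  simp only [← Category.assoc]
  congr 1
  ext
  simp [← rightUnitor_hom]

lemma evNat_id (A : C) : evNat (𝟙 F) A = 𝟙 _ := by
  rw [← Category.id_comp (evNat _ _), comp_evNat, VFunctor.id_app]
  exact evalAt_unit _

lemma evNat_comp (α : F ⟶ G) (β : G ⟶ H) (A : C) :
    evNat (α ≫ β) A = evNat α A ≫ evNat β A := by
  rw [← Category.id_comp (evNat (α ≫ β) _), ← Category.id_comp (evNat α A), comp_evNat,
    comp_evNat, comp_evNat, VFunctor.comp_app, comp_eMul, evalAt_eMul]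

lemma ev_evNat (α : F ⟶ G) (A B : C) :
    F.ev A B ≫ evNat α A = (_ ◁ evNat α B) ≫ G.ev A B := by
  have e : F.ev A B = evalAt (fst (A ⟶[V] B) _ ≫ F.map (.op B) (.op A)) (snd _ _) := by
    have := F.lift_ev (fst (A ⟶[V] B) (F.obj (.op B))) (snd _ _)
    rwa [lift_fst_snd, Category.id_comp] at this
  have e' : _ ◁ evNat α B = lift (fst (A ⟶[V] B) (F.obj (.op B))) (snd _ _ ≫ evNat α B) := by
    ext <;> simp
  rw [e, e', comp_evNat, comp_evNat, lift_ev, ← evalAt_eMul, ← evalAt_eMul]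
  congr 1
  exact VNatTrans.naturality' α (A := .op B) (B := .op A) (fst _ _)

/-- The data of the internal functor `∫ F ⟶ ∫ G` induced by a `V`-natural transformation. -/
def mapFam (α : F ⟶ G) : FamFunctor F.elemFam G.elemFam where
  obj A := evNat α A
  mor A B := _ ◁ evNat α B
  src A B := (ev_evNat α A B).symm
  tgt A B := by simp
  one A := by ext <;> simp
  comp A B D := by ext <;> simp [comp_eMul]

end VFunctor

variable [HasCoproducts.{w} V] [Extensive.{w} V]

variable (V C) in
/-- The internal category `Int C`: the object of objects is `∐ A, 1` and the object of morphisms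
is `∐ A B, C(A, B)`. -/
def intCat : InternalCat V := (intFam V C).total

variable (V C) in
/-- The internal Grothendieck construction: the functor sending a `V`-functor `F : Cᵒᵖ ⥤ V` to
the internal category `∫ F`, with object of objects `∐ A, F A` and object of morphisms
`∐ A B, C(A, B) × F B`, together with the projection to `Int C`. -/
def grothendieck : VFunctor V Cᵒᵖ V ⥤ Over (intCat V C) where
  obj F := Over.mk (Y := F.elemFam.total) F.projFam.total
  map {F G} α := Over.homMk (VFunctor.mapFam α).total
    (FamFunctor.total_comp _ _ _ (fun _ => toUnit_unique _ _) (fun _ _ => by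
      simp [VFunctor.mapFam, VFunctor.projFam]))
  map_id F := by
    ext1
    exact FamFunctor.total_id _ (fun A => VFunctor.evNat_id A) (fun A B => by
      simp [VFunctor.mapFam, VFunctor.evNat_id])
  map_comp {F G H} α β := by
    ext1
    exact (FamFunctor.total_comp _ _ _ (fun A => (VFunctor.evNat_comp α β A).symm)
      (fun A B => by simp [VFunctor.mapFam, VFunctor.evNat_comp])).symm

end Grothendieck

end IntGroth

end

open CategoryTheory Limits MonoidalCategory CartesianMonoidalCategory IntGroth
open scoped MonoidalClosed

noncomputable section

namespace IntGroth

/-! ### Enriched generalities: a fully faithful, essentially surjective `V`-functor has an inverse.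
-/

section EnrichedGeneralities

variable {V : Type u} [Category.{v} V] [CartesianMonoidalCategory V]
variable {C : Type u₁} [EnrichedCategory V C] {D : Type u₂} [EnrichedCategory V D]

/-! A presheaf on `C` and a discrete fibration over `Int C` carry the same data. On the summand
indexed by `(A, B)` the target square of `∫ F` is the projection `C(A, B) × F B → F B` over `C(A, B)
→ 1`, which is a product square. Extensivity makes a coproduct of such pullback squares a pullback
(`FamFunctor.isDiscreteFibration_total`), so `π_F` is a discrete fibration.

Full faithfulness is proved for hom-objects, by the Yoneda lemma in `V`. A map from `X` to the
object of transformations from `F` to `G` is a family `F A × X → G A` natural in `A`; a map from `X`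
to the hom-object between the two fibrations is an internal functor `∫ F × X → ∫ G` over `Int C`. A
functor over the base into a discrete fibration is determined by its map on objects, and a map on
objects over the base extends to such a functor as soon as it respects sources
(`IsDiscreteFibration.functor_ext`, `liftFunctor`). As `V` is cartesian closed and extensive, a map
on objects over `∐ 1` is exactly a family `F A × X → G A`, and respecting sources is exactly
naturality. So `paramFunctor` is a bijection onto the functors over `Int C`. It is compatible with
reindexing in `X`, with composition and with constant transformations, hence gives a `V`-functor
which is invertible on hom-objects and whose underlying functor is `∫`. Ordinary full faithfulness
is the case `X = 1`.

For essential surjectivity let `P : E ⟶ Int C` be a discrete fibration. Extensivity splits `E.obj →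
∐ 1` into fibres `Y A`. Unique lifting gives `C(A, B) × Y B → E.mor`, and the sources of these lifts
give an action `C(A, B) × Y B → Y A`, whose unit and associativity laws follow from uniqueness of
lifts. The comparison from the category of elements of this presheaf is invertible on objects, hence
invertible (`isIso_of_isIso_obj`).

An inverse `V`-functor is then obtained by conjugating with chosen isomorphisms
(`VFunctor.isVEquivalence_of_isIso_map`). -/

lemma eMul_fst_snd (a b c : C) :
    eMul (fst (a ⟶[V] b) (b ⟶[V] c)) (snd _ _) = eComp V a b c := by
  simp [eMul]

lemma tensorHom_comp_eComp {X Y : V} {a b c : C} (f : X ⟶ (a ⟶[V] b)) (g : Y ⟶ (b ⟶[V] c)) :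
    (f ⊗ₘ g) ≫ eComp V a b c = eMul (fst _ _ ≫ f) (snd _ _ ≫ g) := by
  rw [eMul]
  congr 1
  ext <;> simp

lemma eMul_eId {a b : C} (f : 𝟙_ V ⟶ (a ⟶[V] b)) : eMul f (eId V b) = f := by
  simpa using eMul_unit f

namespace VFunctor

/-- A `V`-natural isomorphism from mutually inverse components. -/
def isoOfComponents {F G : VFunctor V C D} (α : VNatTrans F G)
    (β : ∀ A, 𝟙_ V ⟶ (G.obj A ⟶[V] F.obj A)) (hαβ : ∀ A, eMul (α.app A) (β A) = eId V _)
    (hβα : ∀ A, eMul (β A) (α.app A) = eId V _) : F ≅ G where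
  hom := α
  inv :=
    { app := β
      naturality A B := by
        have hα : ∀ {X : V} (A : C), eMul (toUnit X ≫ α.app A) (toUnit X ≫ β A) =
            toUnit X ≫ eId V _ := fun A => by rw [← comp_eMul, hαβ]
        have hβ : ∀ {X : V} (A : C), eMul (toUnit X ≫ β A) (toUnit X ≫ α.app A) =
            toUnit X ≫ eId V _ := fun A => by rw [← comp_eMul, hβα]
        -- Insert `β A` followed by `α A` in front of `G.map A B`, move `α` across by its
        -- naturality, and cancel `α B` against `β B`.
        calc eMul (G.map A B) (toUnit _ ≫ β B)
            = eMul (eMul (toUnit _ ≫ β A) (eMul (toUnit _ ≫ α.app A) (G.map A B)))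
                (toUnit _ ≫ β B) := by rw [← eMul_assoc (toUnit _ ≫ β A), hβ, unit_eMul]
          _ = _ := by rw [← α.naturality, eMul_assoc, eMul_assoc, hα, eMul_unit] }
  hom_inv_id := VFunctor.hom_ext hαβ
  inv_hom_id := VFunctor.hom_ext hβα

section Inverse

variable (F : VFunctor V C D) [∀ a b, IsIso (F.map a b)] (p : D → C)
  (x : ∀ d, 𝟙_ V ⟶ (F.obj (p d) ⟶[V] d)) (y : ∀ d, 𝟙_ V ⟶ (d ⟶[V] F.obj (p d)))

/-- The action on hom-objects of an inverse of a fully faithful `V`-functor. -/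
def inverseMap (d d' : D) : (d ⟶[V] d') ⟶ (p d ⟶[V] p d') :=
  eMul (eMul (toUnit _ ≫ x d) (𝟙 _)) (toUnit _ ≫ y d') ≫ inv (F.map (p d) (p d'))

/-- The working description of `inverseMap`: since `F.map` is invertible, every identity about the
inverse may be tested after applying `F`, where the inverse becomes conjugation by `x` and `y`. -/
lemma comp_inverseMap_map {X : V} {d d' : D} (f : X ⟶ (d ⟶[V] d')) :
    f ≫ F.inverseMap p x y d d' ≫ F.map _ _ =
      eMul (eMul (toUnit _ ≫ x d) f) (toUnit _ ≫ y d') := by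
  rw [inverseMap]
  simp [comp_eMul]

variable {x y}

/-- Conjugation is multiplicative because the inner `y d'` and `x d'` cancel. -/
lemma inverseMap_cancel (hyx : ∀ d, eMul (y d) (x d) = eId V _) {X : V} {d d' d'' : D}
    (f : X ⟶ (d ⟶[V] d')) (g : X ⟶ (d' ⟶[V] d'')) :
    eMul (eMul (eMul (toUnit _ ≫ x d) f) (toUnit _ ≫ y d'))
      (eMul (eMul (toUnit _ ≫ x d') g) (toUnit _ ≫ y d'')) =
    eMul (eMul (toUnit _ ≫ x d) (eMul f g)) (toUnit _ ≫ y d'') := by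
  have hy : eMul (toUnit X ≫ y d') (toUnit X ≫ x d') = toUnit X ≫ eId V _ := by
    rw [← comp_eMul, hyx]
  simp only [eMul_assoc]
  rw [← eMul_assoc (toUnit X ≫ y d'), hy, unit_eMul]

/-- The inverse `V`-functor of a fully faithful and essentially surjective `V`-functor. -/
def inverse (hxy : ∀ d, eMul (x d) (y d) = eId V _)
    (hyx : ∀ d, eMul (y d) (x d) = eId V _) :
    VFunctor V D C where
  obj := p
  map := F.inverseMap p x y
  map_id d := by
    rw [← cancel_mono (F.map _ _), Category.assoc, comp_inverseMap_map, F.map_id]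
    simp [eMul_eId, hxy]
  map_comp d d' d'' := by
    rw [tensorHom_comp_eComp, ← cancel_mono (F.map _ _), F.eMul_map, Category.assoc,
      Category.assoc, Category.assoc, comp_inverseMap_map, comp_inverseMap_map,
      comp_inverseMap_map, F.inverseMap_cancel p hyx, eMul_fst_snd]

/-- A `V`-functor which is fully faithful and essentially surjective (with the given choice of
preimages) is an equivalence of `V`-categories. -/
lemma isVEquivalence_of_isIso_map (hxy : ∀ d, eMul (x d) (y d) = eId V _)
    (hyx : ∀ d, eMul (y d) (x d) = eId V _) :
    F.IsVEquivalence := by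
  have cancel_yx {X : V} (d : D) : eMul (toUnit X ≫ y d) (toUnit X ≫ x d) = toUnit X ≫ eId V _ := by
    rw [← comp_eMul, hyx]
  have hmap {a b : C} {X : V} (g : X ⟶ (F.obj a ⟶[V] F.obj b)) :
    (g ≫ inv (F.map a b)) ≫ F.map a b = g := by simp
  -- The unit at `c` and its inverse are the preimages under `F` of the chosen isomorphism between
  -- `F c` and `F (p (F c))`; their laws are checked after applying `F`.
  let η (c : C) : 𝟙_ V ⟶ (c ⟶[V] p (F.obj c)) := y (F.obj c) ≫ inv (F.map c (p (F.obj c)))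
  let θ (c : C) : 𝟙_ V ⟶ (p (F.obj c) ⟶[V] c) := x (F.obj c) ≫ inv (F.map (p (F.obj c)) c)
  refine ⟨F.inverse p hxy hyx, ⟨?_⟩, ⟨?_⟩⟩
  · refine isoOfComponents
      { app := η
        naturality := fun a b => ?_ } θ ?_ ?_
    · change eMul (𝟙 _) (toUnit _ ≫ η b) =
        eMul (toUnit _ ≫ η a) (F.map a b ≫ F.inverseMap p x y _ _)
      rw [← cancel_mono (F.map _ _), F.eMul_map, F.eMul_map, Category.assoc (F.map a b),
        F.comp_inverseMap_map, Category.id_comp, ← Category.assoc, hmap, ← Category.assoc, hmap,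
        ← eMul_assoc, ← eMul_assoc, cancel_yx, unit_eMul]
    · intro c
      change eMul (y (F.obj c) ≫ inv (F.map c (p (F.obj c))))
        (x (F.obj c) ≫ inv (F.map (p (F.obj c)) c)) = eId V c
      rw [← cancel_mono (F.map _ _), F.eMul_map, hmap, hmap, F.map_id, hyx]
    · intro c
      change eMul (x (F.obj c) ≫ inv (F.map (p (F.obj c)) c))
        (y (F.obj c) ≫ inv (F.map c (p (F.obj c)))) = eId V (p (F.obj c))
      rw [← cancel_mono (F.map _ _), F.eMul_map, hmap, hmap, F.map_id, hxy]
  -- The counit consists of the chosen isomorphisms `x d` themselves. Its naturality is the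
  -- conjugation formula with `y d'` and `x d'` cancelled.
  · refine isoOfComponents
      { app := fun d => x d
        naturality := fun d d' => ?_ } (fun d => y d) hxy hyx
    change eMul (F.inverseMap p x y d d' ≫ F.map _ _) (toUnit _ ≫ x d') =
      eMul (toUnit _ ≫ x d) (𝟙 _)
    rw [← Category.id_comp (F.inverseMap p x y d d' ≫ F.map _ _), F.comp_inverseMap_map,
      eMul_assoc, cancel_yx, eMul_unit]

end Inverse

end VFunctor

end EnrichedGeneralities

/-! ### Functors into discrete fibrations, and discrete fibrations from families of pullback
squares. -/

section DiscreteFibrations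

attribute [local simp] pullback.lift_fst pullback.lift_snd pullback.lift_fst_assoc
  pullback.lift_snd_assoc

variable {V : Type u} [Category.{v} V] [HasPullbacks V]

namespace IsDiscreteFibration

variable {B E E' : InternalCat V} {P : E ⟶ B} {Q : E' ⟶ B}

/-- Functors over the base of a discrete fibration are determined by their action on objects. -/
lemma functor_ext (hQ : IsDiscreteFibration Q) {F G : E ⟶ E'} (h : F ≫ Q = G ≫ Q)
    (h₀ : F.obj = G.obj) : F = G := by
  apply InternalFunctor.hom_ext h₀
  -- A map into `E'.mor` is determined by its target and its image in `B`, and the targets are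
  -- controlled by the maps on objects.
  apply IsPullback.hom_ext hQ
  · simp [h₀]
  · exact congrArg InternalFunctor.mor h

variable (hQ : IsDiscreteFibration Q) (P) (a : E.obj ⟶ E'.obj) (ha : a ≫ Q.obj = P.obj)

/-- The only possible action on morphisms of a functor into a discrete fibration with given
action on objects. -/
def liftMor : E.mor ⟶ E'.mor := IsPullback.lift hQ (E.tgt ≫ a) P.mor (by simp [ha])

lemma liftMor_tgt : hQ.liftMor P a ha ≫ E'.tgt = E.tgt ≫ a := IsPullback.lift_fst hQ _ _ _

lemma liftMor_mor : hQ.liftMor P a ha ≫ Q.mor = P.mor := IsPullback.lift_snd hQ _ _ _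

/-- A map on objects over the base of a discrete fibration which is compatible with sources
extends to an internal functor. -/
def liftFunctor (hs : hQ.liftMor P a ha ≫ E'.src = E.src ≫ a) : E ⟶ E' :=
  -- Identities and composition are preserved automatically: both laws are equalities of maps into
  -- `E'.mor`, hence may be tested on targets and on images in `B`. Only sources escape this
  -- argument, which is why `hs` is assumed.
  InternalFunctor.mk' a (hQ.liftMor P a ha) hs (hQ.liftMor_tgt P a ha)
    (by
      apply IsPullback.hom_ext hQ
      · simp [liftMor_tgt]
      · simp [liftMor_mor, reassoc_of% ha])
    (by
      intro X f g h
      apply IsPullback.hom_ext hQ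
      · simp [liftMor_tgt]
      · rw [Q.mul_mor, Category.assoc, liftMor_mor, P.mul_mor]
        exact InternalCat.mul_congr (by simp [liftMor_mor]) (by simp [liftMor_mor]))

lemma liftFunctor_comp (hs : hQ.liftMor P a ha ≫ E'.src = E.src ≫ a) :
    hQ.liftFunctor P a ha hs ≫ Q = P :=
  InternalFunctor.hom_ext ha (hQ.liftMor_mor P a ha)

variable {P} in
/-- A functor between discrete fibrations which is invertible on objects is invertible. -/
lemma isIso_of_isIso_obj (hP : IsDiscreteFibration P) (hQ : IsDiscreteFibration Q) (F : E ⟶ E')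
    (hF : F ≫ Q = P) [IsIso F.obj] : IsIso F := by
  have h₀ : inv F.obj ≫ P.obj = Q.obj := by
    rw [IsIso.inv_comp_eq]; exact (congrArg InternalFunctor.obj hF).symm
  have h₁ : F.mor ≫ Q.mor = P.mor := congrArg InternalFunctor.mor hF
  have hm : F.mor ≫ hP.liftMor Q (inv F.obj) h₀ = 𝟙 _ := by
    apply IsPullback.hom_ext hP
    · simp [liftMor_tgt]
    · simp [liftMor_mor, h₁]
  have hm' : hP.liftMor Q (inv F.obj) h₀ ≫ F.mor = 𝟙 _ := by
    apply IsPullback.hom_ext hQ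
    · simp [reassoc_of% (hP.liftMor_tgt Q (inv F.obj) h₀)]
    · simp [h₁, liftMor_mor]
  -- The lift `hP.liftMor Q (inv F.obj) h₀` is already a two-sided inverse of `F.mor`, so its
  -- compatibility with sources follows from that of `F` once the invertible `F.obj` is cancelled.
  let G := hP.liftFunctor Q (inv F.obj) h₀ (by
    rw [← cancel_mono F.obj, Category.assoc, Category.assoc, IsIso.inv_hom_id, Category.comp_id,
      ← F.src, reassoc_of% hm'])
  exact ⟨G, InternalFunctor.hom_ext (IsIso.hom_inv_id _) hm,
    InternalFunctor.hom_ext (IsIso.inv_hom_id _) hm'⟩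

end IsDiscreteFibration

variable [HasCoproducts.{w} V] [Extensive.{w} V] {I : Type w} {D E : FamCat V I}

open FamCat in
/-- A functor of families of internal categories whose target squares are pullbacks is a discrete
fibration on total categories. -/
lemma FamFunctor.isDiscreteFibration_total (F : FamFunctor D E)
    (h : ∀ i j, IsPullback (D.t i j) (F.mor i j) (F.obj j) (E.t i j)) :
    IsDiscreteFibration F.total := by
  -- Uniqueness half of the pullback property. Locally `f` and `g` lie in single summands; their
  -- equal images in `E.mor` force these summands to have the same index, and there the pullback
  -- square of that summand applies.
  have ext {T : V} (f g : T ⟶ D.mor) (h₁ : f ≫ D.tgt = g ≫ D.tgt)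
      (h₂ : f ≫ F.total.mor = g ≫ F.total.mor) : f = g := by
    refine mor_local f f g fun i j S k f' hf => ?_
    refine mor_local (k ≫ g) _ _ fun i' j' S' k' g' hg => ?_
    have hm : (k' ≫ f' ≫ F.mor i j) ≫ E.inMor i j = (g' ≫ F.mor i' j') ≫ E.inMor i' j' := by
      simp only [Category.assoc, ← F.in_total_mor]
      rw [← reassoc_of% hg, ← reassoc_of% hf, h₂]
    by_cases hij : (i, j) = (i', j')
    · obtain ⟨rfl, rfl⟩ := Prod.mk.inj hij
      rw [hf, hg, ← Category.assoc]
      congr 1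
      apply (h i j).hom_ext
      · rw [← cancel_mono (D.inObj j)]
        simp only [Category.assoc, ← in_tgt]
        rw [← reassoc_of% hg, ← reassoc_of% hf, h₁]
      · rw [← cancel_mono (E.inMor i j)]; simpa using hm
    -- An object mapping compatibly into two different summands admits at most one map to any
    -- object.
    · exact mor_eq_of_ne _ _ hm hij _ _
  have exists_lift {T : V} (a : T ⟶ D.obj) (b : T ⟶ E.mor) (hab : a ≫ F.total.obj = b ≫ E.tgt) :
      ∃ m : T ⟶ D.mor, m ≫ D.tgt = a ∧ m ≫ F.total.mor = b := by
    -- Existence half: the pair `(a, b)` must factor through the comparison from `D.mor` to the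
    -- pullback. Cutting first along `b` and then along `a` reduces this to single summands. The
    -- local factorizations need no compatibility, since the pieces form a coproduct decomposition.
    obtain ⟨m, hm⟩ := factors_of_local (X := fun p : I × I => E.Y p.1 p.2)
      (pullback.lift D.tgt F.total.mor F.total.tgt.symm) (pullback.lift a b hab) b (by
        rintro ⟨i, j⟩ S k g hg
        replace hg : k ≫ b = g ≫ E.inMor i j := hg
        refine factors_of_local (X := D.X) _ _ (k ≫ a) fun j' S' l x hx => ?_
        replace hx : l ≫ k ≫ a = x ≫ D.inObj j' := hx
        have hj : (x ≫ F.obj j') ≫ E.inObj j' = (l ≫ g ≫ E.t i j) ≫ E.inObj j := by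
          simp only [Category.assoc, ← F.in_total_obj, ← in_tgt]
          rw [← reassoc_of% hx, ← reassoc_of% hg, hab]
        by_cases hjj : j' = j
        · subst hjj
          refine ⟨(h i j').lift x (l ≫ g) (by
            rw [← cancel_mono (E.inObj j')]; simpa using hj) ≫ D.inMor i j', ?_⟩
          apply pullback.hom_ext
          · simp [hx, reassoc_of% ((h i j').lift_fst)]
          · simp [hg, reassoc_of% ((h i j').lift_snd)]
        -- When `b` has target index `j` and `a` lies over `j' ≠ j`, disjointness gives the test
        -- object exactly one map to every object, so some factorization exists and is automatically
        -- correct.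
        · obtain ⟨m⟩ := nonempty_hom_of_ne _ _ hj hjj D.mor
          exact ⟨m, eq_of_ne _ _ hj hjj _ _⟩)
    exact ⟨m, by simpa using congrArg (· ≫ pullback.fst _ _) hm,
      by simpa using congrArg (· ≫ pullback.snd _ _) hm⟩
  choose m hm₁ hm₂ using @exists_lift
  exact ⟨⟨F.total.tgt.symm⟩, ⟨PullbackCone.IsLimit.mk _ (fun s => m s.fst s.snd s.condition)
    (fun s => hm₁ _ _ _) (fun s => hm₂ _ _ _)
    (fun s k h₁ h₂ => ext _ _ (h₁.trans (hm₁ _ _ _).symm) (h₂.trans (hm₂ _ _ _).symm))⟩⟩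

end DiscreteFibrations

/-! ### Distributivity of products over coproducts. -/

section TensorCoproduct

variable {V : Type u} [Category.{v} V] [CartesianMonoidalCategory V] [BraidedCategory V]
  [MonoidalClosed V] [HasCoproducts.{w} V] {I : Type w} {Y : I → V} {X Z : V}

/-- Maps out of the product of a coproduct with an object. -/
def sigmaTensorDesc (f : ∀ i, Y i ⊗ X ⟶ Z) : (∐ Y) ⊗ X ⟶ Z :=
  (β_ _ _).hom ≫ MonoidalClosed.uncurry
    (Limits.Sigma.desc fun i => MonoidalClosed.curry ((β_ _ _).hom ≫ f i))

lemma ι_sigmaTensorDesc (f : ∀ i, Y i ⊗ X ⟶ Z) (i : I) :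
    Sigma.ι Y i ▷ X ≫ sigmaTensorDesc f = f i := by
  rw [sigmaTensorDesc, BraidedCategory.braiding_naturality_left_assoc,
    ← MonoidalClosed.uncurry_natural_left, Limits.Sigma.ι_desc, MonoidalClosed.uncurry_curry]
  rw [← Category.assoc]
  have : (β_ (Y i) X).hom ≫ (β_ X (Y i)).hom = 𝟙 _ := by ext <;> simp
  rw [this, Category.id_comp]

/-- Taking the product with `X` is a left adjoint: currying turns maps out of `(∐ Y) ⊗ X` into maps
out of `∐ Y`. The braiding only moves `X` to the side on which currying is available. -/
lemma sigmaTensor_hom_ext {a b : (∐ Y) ⊗ X ⟶ Z}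
    (h : ∀ i, Sigma.ι Y i ▷ X ≫ a = Sigma.ι Y i ▷ X ≫ b) : a = b := by
  rw [← cancel_epi (β_ _ _).hom]
  apply MonoidalClosed.curry_injective
  apply Limits.Sigma.hom_ext
  intro i
  rw [← MonoidalClosed.curry_natural_left, ← MonoidalClosed.curry_natural_left,
    BraidedCategory.braiding_naturality_right_assoc,
    BraidedCategory.braiding_naturality_right_assoc, h]

variable [HasPullbacks V] {D : FamCat V I}

lemma FamCat.objTensor_ext {a b : D.obj ⊗ X ⟶ Z}
    (h : ∀ i, D.inObj i ▷ X ≫ a = D.inObj i ▷ X ≫ b) : a = b :=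
  sigmaTensor_hom_ext h

lemma FamCat.morTensor_ext {a b : D.mor ⊗ X ⟶ Z}
    (h : ∀ i j, D.inMor i j ▷ X ≫ a = D.inMor i j ▷ X ≫ b) : a = b :=
  sigmaTensor_hom_ext fun p => h p.1 p.2

end TensorCoproduct

attribute [local instance] MonoidalClosed.enrichedCategorySelf

/-! ### The projection from the category of elements is a discrete fibration. -/

section ElementsFibration

variable {V : Type u} [Category.{v} V] [CartesianMonoidalCategory V] [MonoidalClosed V]
  [HasPullbacks V] {C : Type w} [EnrichedCategory V C] [BraidedCategory V]
  [HasCoproducts.{w} V] [Extensive.{w} V]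

namespace VFunctor

/-- On the summand indexed by `(A, B)` the square has corner `1` and the two product projections of
`C(A, B) × F B` as its legs, so it is a pullback. -/
lemma isDiscreteFibration_proj (F : VFunctor V Cᵒᵖ V) : IsDiscreteFibration F.projFam.total := by
  refine FamFunctor.isDiscreteFibration_total _ fun A B => ?_
  exact ⟨⟨toUnit_unique _ _⟩, ⟨PullbackCone.IsLimit.mk _ (fun s => lift s.snd s.fst)
    (fun s => lift_snd _ _) (fun s => lift_fst _ _)
    (fun s k h₁ h₂ => CartesianMonoidalCategory.hom_ext _ _
      (h₂.trans (lift_fst _ _).symm) (h₁.trans (lift_snd _ _).symm))⟩⟩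

variable {F G H : VFunctor V Cᵒᵖ V} {X : V}

/-- The action on morphisms of a parametrized functor between categories of elements is determined
by the components of its action on objects. -/
lemma inMor_whiskerRight_eq {a : F.elemFam.obj ⊗ X ⟶ G.elemFam.obj}
    {b : ∀ A, F.obj (.op A) ⊗ X ⟶ G.obj (.op A)}
    (hab : ∀ A, F.elemFam.inObj A ▷ X ≫ a = b A ≫ G.elemFam.inObj A)
    {m : F.elemFam.mor ⊗ X ⟶ G.elemFam.mor}
    (ht : m ≫ G.elemFam.tgt = F.elemFam.tgt ▷ X ≫ a)
    (hm : m ≫ G.projFam.total.mor = fst _ _ ≫ F.projFam.total.mor) (A B : C) :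
    F.elemFam.inMor A B ▷ X ≫ m =
      lift (fst _ _ ≫ fst _ _) (lift (fst _ _ ≫ snd _ _) (snd _ _) ≫ b B) ≫
        G.elemFam.inMor A B := by
  -- An arrow of `∫ G` is determined by its target and its image in `Int C`: here the target is `b
  -- B` applied to the given element, and the image is the given element of `C(A, B)`.
  apply IsPullback.hom_ext G.isDiscreteFibration_proj
  · change (_ ≫ m) ≫ G.elemFam.tgt = (_ ≫ _) ≫ G.elemFam.tgt
    rw [Category.assoc, ht, Category.assoc, FamCat.in_tgt, ← comp_whiskerRight_assoc,
      FamCat.in_tgt, comp_whiskerRight_assoc, hab, lift_snd_assoc, Category.assoc,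
      ← Category.assoc, ← Category.assoc]
    congr 2
    ext <;> simp
  · rw [Category.assoc, hm, Category.assoc, FamFunctor.in_total_mor, whiskerRight_fst_assoc,
      FamFunctor.in_total_mor]
    simp [projFam]

end VFunctor

end ElementsFibration

/-! ### Evaluation of generalized elements of internal homs. -/

section Evaluation

variable {V : Type u} [Category.{v} V] [CartesianMonoidalCategory V] [MonoidalClosed V]

/-- Uncurrying is evaluation at the universal pair of projections from `P ⊗ X`; this lets transposes
be manipulated by the rules for `evalAt`. -/
lemma evalAt_snd_fst {X P Q : V} (φ : X ⟶ (ihom P).obj Q) :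
    evalAt (snd P X ≫ φ) (fst P X) = MonoidalClosed.uncurry φ := by
  rw [evalAt, MonoidalClosed.uncurry_natural_left, ← Category.assoc]
  have : lift (fst P X) (𝟙 _) ≫ P ◁ snd P X = 𝟙 _ := by ext <;> simp
  rw [this, Category.id_comp]

lemma lift_uncurry {X Y P Q : V} (φ : X ⟶ (ihom P).obj Q) (x : Y ⟶ P) (k : Y ⟶ X) :
    lift x k ≫ MonoidalClosed.uncurry φ = evalAt (k ≫ φ) x := by
  rw [← evalAt_snd_fst, comp_evalAt]
  simp

lemma evalAt_comp_curry {X Y P Q : V} (f : P ⊗ X ⟶ Q) (x : Y ⟶ P) (k : Y ⟶ X) :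
    evalAt (k ≫ MonoidalClosed.curry f) x = lift x k ≫ f := by
  rw [← lift_uncurry, MonoidalClosed.uncurry_curry]

/-- The universal pair on `P ⊗ X` is among the tests, and there evaluation is uncurrying, which is
injective. -/
lemma evalAt_ext {X P Q : V} {φ ψ : X ⟶ (ihom P).obj Q}
    (h : ∀ {Y : V} (k : Y ⟶ X) (x : Y ⟶ P), evalAt (k ≫ φ) x = evalAt (k ≫ ψ) x) : φ = ψ := by
  apply MonoidalClosed.uncurry_injective
  rw [← evalAt_snd_fst, ← evalAt_snd_fst, h]

end Evaluation

/-! ### Reindexing and graphs of parametrized functors are compatible with the projections. -/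

section InternalFunctors

variable {V : Type u} [Category.{v} V] [CartesianMonoidalCategory V] [HasPullbacks V]

namespace InternalCat

lemma reindex_proj (A : InternalCat V) {X Y : V} (k : Y ⟶ X) :
    A.reindex k ≫ A.proj X = A.proj Y := by
  ext <;> simp

lemma graph_proj {A B : InternalCat V} {X : V} (F : A.prodConst X ⟶ B) :
    graph F ≫ B.proj X = F := by
  ext <;> simp

lemma reindex_proj_assoc (A : InternalCat V) {X Y : V} (k : Y ⟶ X) {B : InternalCat V}
    (F : A ⟶ B) : A.reindex k ≫ A.proj X ≫ F = A.proj Y ≫ F := by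
  rw [← Category.assoc, reindex_proj]

lemma graph_proj_assoc {A B D : InternalCat V} {X : V} (F : A.prodConst X ⟶ B) (G : B ⟶ D) :
    graph F ≫ B.proj X ≫ G = F ≫ G := by
  rw [← Category.assoc, graph_proj]

end InternalCat

end InternalFunctors

/-! ### Parametrized `V`-natural transformations as parametrized functors over `Int C`. -/

section ParametrizedFunctors

variable {V : Type u} [Category.{v} V] [CartesianMonoidalCategory V] [MonoidalClosed V]
  [HasPullbacks V] {C : Type w} [EnrichedCategory V C] [BraidedCategory V]

namespace VFunctor

variable {F G H : VFunctor V Cᵒᵖ V} {X : V}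

/-- The component `F A × X ⟶ G A` of a parametrized `V`-natural transformation. -/
def paramEv (α : ParamNatTrans X F G) (A : C) : F.obj (.op A) ⊗ X ⟶ G.obj (.op A) :=
  MonoidalClosed.uncurry (α.app (.op A))

lemma lift_paramEv (α : ParamNatTrans X F G) (A : C) {Y : V} (x : Y ⟶ F.obj (.op A))
    (k : Y ⟶ X) : lift x k ≫ paramEv α A = evalAt (k ≫ α.app (.op A)) x :=
  lift_uncurry _ _ _

/-- This is the naturality of `α` transposed from internal homs to generalized elements, the form in
which it can be compared with the source maps of `∫ F` and `∫ G`. -/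
lemma paramEv_natural (α : ParamNatTrans X F G) {A B : C} {Y : V} (c : Y ⟶ (A ⟶[V] B))
    (x : Y ⟶ F.obj (.op B)) (k : Y ⟶ X) :
    lift (lift c x ≫ F.ev A B) k ≫ paramEv α A =
      lift c (lift x k ≫ paramEv α B) ≫ G.ev A B := by
  rw [lift_paramEv, lift_paramEv, lift_ev, lift_ev, ← evalAt_eMul, ← evalAt_eMul]
  congr 1
  -- An element of `C(A, B)` is an arrow from `.op B` to `.op A`, whence the reversed indices.
  have := congrArg (lift c k ≫ ·) (α.naturality (.op B) (.op A))
  simp only [comp_eMul] at this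
  erw [lift_fst_assoc, lift_fst_assoc, lift_snd_assoc, lift_snd_assoc] at this
  exact this

/-- A parametrized `V`-natural transformation from its components. -/
def paramNatTransOfEv (b : ∀ A, F.obj (.op A) ⊗ X ⟶ G.obj (.op A))
    (hb : ∀ {A B : C} {Y : V} (c : Y ⟶ (A ⟶[V] B)) (x : Y ⟶ F.obj (.op B)) (k : Y ⟶ X),
      lift (lift c x ≫ F.ev A B) k ≫ b A = lift c (lift x k ≫ b B) ≫ G.ev A B) :
    ParamNatTrans X F G where
  app A := MonoidalClosed.curry (b A.unop)
  naturality A B := by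
    apply evalAt_ext
    intro Y k x
    rw [comp_eMul, comp_eMul, evalAt_eMul, evalAt_eMul]
    have := hb (A := B.unop) (B := A.unop) (k ≫ fst _ _) x (k ≫ snd _ _)
    rw [lift_ev, lift_ev, ← evalAt_comp_curry, ← evalAt_comp_curry] at this
    simp only [Category.assoc] at this ⊢
    exact this

lemma paramEv_paramNatTransOfEv (b : ∀ A, F.obj (.op A) ⊗ X ⟶ G.obj (.op A))
    (hb : ∀ {A B : C} {Y : V} (c : Y ⟶ (A ⟶[V] B)) (x : Y ⟶ F.obj (.op B)) (k : Y ⟶ X),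
      lift (lift c x ≫ F.ev A B) k ≫ b A = lift c (lift x k ≫ b B) ≫ G.ev A B) (A : C) :
    paramEv (paramNatTransOfEv b hb) A = b A :=
  MonoidalClosed.uncurry_curry _

lemma paramNatTrans_ext_ev {α β : ParamNatTrans X F G} (h : ∀ A, paramEv α A = paramEv β A) :
    α = β := by
  ext A
  exact MonoidalClosed.uncurry_injective (h A.unop)

variable [HasCoproducts.{w} V] [Extensive.{w} V]

/-- The action on objects of the parametrized functor between categories of elements given by a
parametrized `V`-natural transformation. -/
def paramObj (α : ParamNatTrans X F G) : F.elemFam.obj ⊗ X ⟶ G.elemFam.obj :=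
  sigmaTensorDesc fun A => paramEv α A ≫ G.elemFam.inObj A

lemma inObj_paramObj (α : ParamNatTrans X F G) (A : C) :
    F.elemFam.inObj A ▷ X ≫ paramObj α = paramEv α A ≫ G.elemFam.inObj A :=
  ι_sigmaTensorDesc _ _

/-- The projection from `∫ F × cst X` to `Int C`. -/
abbrev paramProj (F : VFunctor V Cᵒᵖ V) (X : V) :
    F.elemFam.total.prodConst X ⟶ (intFam V C).total :=
  InternalCat.proj F.elemFam.total X ≫ F.projFam.total

/-- On the summand of `A` both sides factor through the inclusion of the terminal summand indexed by
`A`, hence coincide. -/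
lemma paramObj_comp (α : ParamNatTrans X F G) :
    paramObj α ≫ G.projFam.total.obj = (paramProj F X).obj := by
  apply FamCat.objTensor_ext
  intro A
  rw [← Category.assoc, inObj_paramObj, Category.assoc, FamFunctor.in_total_obj]
  change _ = F.elemFam.inObj A ▷ X ≫ fst _ _ ≫ F.projFam.total.obj
  rw [whiskerRight_fst_assoc, FamFunctor.in_total_obj, ← Category.assoc, ← Category.assoc]
  congr 1
  exact toUnit_unique _ _

/-- The parametrized functor between categories of elements given by a parametrized `V`-natural
transformation. -/
def paramFunctor (α : ParamNatTrans X F G) :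
    F.elemFam.total.prodConst X ⟶ G.elemFam.total :=
  G.isDiscreteFibration_proj.liftFunctor (paramProj F X) (paramObj α) (paramObj_comp α) (by
    -- Only compatibility with sources is left to check; on the summand indexed by `(A, B)` it is
    -- `paramEv_natural`.
    apply FamCat.morTensor_ext
    intro A B
    rw [← Category.assoc, inMor_whiskerRight_eq (inObj_paramObj α)
      (G.isDiscreteFibration_proj.liftMor_tgt _ _ _) (G.isDiscreteFibration_proj.liftMor_mor _ _ _)]
    change (_ ≫ _) ≫ G.elemFam.src = _ ≫ F.elemFam.src ▷ X ≫ _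
    rw [Category.assoc, FamCat.in_src, ← comp_whiskerRight_assoc, FamCat.in_src,
      comp_whiskerRight_assoc, inObj_paramObj, ← Category.assoc, ← Category.assoc,
      ← paramEv_natural]
    congr 2
    ext <;> simp)

lemma paramFunctor_comp (α : ParamNatTrans X F G) :
    paramFunctor α ≫ G.projFam.total = paramProj F X :=
  IsDiscreteFibration.liftFunctor_comp _ _ _ _ _

lemma inObj_paramFunctor_obj (α : ParamNatTrans X F G) (A : C) :
    F.elemFam.inObj A ▷ X ≫ (paramFunctor α).obj = paramEv α A ≫ G.elemFam.inObj A :=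
  inObj_paramObj α A

/-- Because `∫ G` is a discrete fibration, functors over `Int C` need only be compared on objects,
and there summand by summand. This reduces the compatibilities of `paramFunctor` to identities
between components. -/
lemma paramFunctor_ext {U W : F.elemFam.total.prodConst X ⟶ G.elemFam.total}
    (hU : U ≫ G.projFam.total = paramProj F X) (hW : W ≫ G.projFam.total = paramProj F X)
    (h : ∀ A, F.elemFam.inObj A ▷ X ≫ U.obj = F.elemFam.inObj A ▷ X ≫ W.obj) : U = W :=
  G.isDiscreteFibration_proj.functor_ext (hU.trans hW.symm) (FamCat.objTensor_ext h)

lemma paramFunctor_injective :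
    Function.Injective (paramFunctor : ParamNatTrans X F G → _) := by
  intro α β h
  apply paramNatTrans_ext_ev
  intro A
  rw [← cancel_mono (G.elemFam.inObj A), ← inObj_paramFunctor_obj, h, inObj_paramFunctor_obj]

/-- Together with injectivity this is full faithfulness in parametrized form. A functor over `Int C`
preserves the index of objects, so its object map splits into components `F A × X → G A`; their
naturality is forced by preservation of sources. -/
lemma exists_paramFunctor_eq (U : F.elemFam.total.prodConst X ⟶ G.elemFam.total)
    (hU : U ≫ G.projFam.total = paramProj F X) : ∃ α, paramFunctor α = U := by
  have h₀ : U.obj ≫ G.projFam.total.obj = fst _ _ ≫ F.projFam.total.obj :=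
    congrArg InternalFunctor.obj hU
  have h₁ : U.mor ≫ G.projFam.total.mor = fst _ _ ≫ F.projFam.total.mor :=
    congrArg InternalFunctor.mor hU
  -- The restriction of `U.obj` to `F A × X` lies over the summand of `∐ 1` indexed by `A`, so by
  -- extensivity it factors through `G A`.
  have hb (A : C) : ∃ b : F.obj (.op A) ⊗ X ⟶ G.obj (.op A),
      b ≫ G.elemFam.inObj A = F.elemFam.inObj A ▷ X ≫ U.obj := by
    refine exists_lift_summand (fun A => toUnit (G.obj (.op A))) _ A (toUnit _) ?_
    have e : Limits.Sigma.map (fun A => toUnit (G.obj (.op A))) = G.projFam.total.obj := by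
      apply Limits.Sigma.hom_ext
      intro A
      rw [Limits.Sigma.ι_map]
      exact (G.projFam.in_total_obj A).symm
    refine (congrArg _ e).trans ?_
    change (F.elemFam.inObj A ▷ X ≫ U.obj) ≫ G.projFam.total.obj =
      toUnit _ ≫ (intFam V C).inObj A
    rw [Category.assoc, h₀, whiskerRight_fst_assoc, FamFunctor.in_total_obj, ← Category.assoc]
    exact congrArg (· ≫ _) (toUnit_unique _ _)
  choose b hb using hb
  refine ⟨paramNatTransOfEv b fun {A B Y} c x k => ?_, ?_⟩
  -- Targets and images in `Int C` determine `U.mor` on each summand. Taking sources of the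
  -- resulting formula and cancelling the monomorphism `G A → ∐ G` gives naturality.
  · have hm := inMor_whiskerRight_eq (fun A => (hb A).symm) (U.tgt) h₁ A B
    have := congrArg (lift (lift c x) k ≫ · ≫ G.elemFam.src) hm
    have hs : U.mor ≫ G.elemFam.src = F.elemFam.src ▷ X ≫ U.obj := U.src
    dsimp only at this
    rw [Category.assoc, hs, ← comp_whiskerRight_assoc, FamCat.in_src, comp_whiskerRight_assoc,
      ← hb, Category.assoc, FamCat.in_src] at this
    rw [← cancel_mono (G.elemFam.inObj A), Category.assoc, Category.assoc]
    have e : lift (lift c x) k ≫ lift (fst _ _ ≫ fst _ _) (lift (fst _ _ ≫ snd _ _) (snd _ _) ≫ b B)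
        = lift c (lift x k ≫ b B) := by
      simp [← Category.assoc]
    rw [reassoc_of% e] at this
    simpa using this
  · apply paramFunctor_ext (paramFunctor_comp _) hU
    intro A
    rw [inObj_paramFunctor_obj, paramEv_paramNatTransOfEv, hb]

/-- Naturality in the parameter object: it is what allows the Yoneda lemma to turn the assignment
into a map of hom-objects. -/
lemma paramFunctor_res {Y : V} (k : Y ⟶ X) (α : ParamNatTrans X F G) (β : ParamNatTrans Y F G)
    (h : ∀ A, β.app A = k ≫ α.app A) :
    paramFunctor β = InternalCat.reindex F.elemFam.total k ≫ paramFunctor α := by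
  refine paramFunctor_ext (paramFunctor_comp _) ?_ fun A => ?_
  · rw [Category.assoc, paramFunctor_comp, paramProj, InternalCat.reindex_proj_assoc]
  · rw [inObj_paramFunctor_obj]
    change _ = F.elemFam.inObj A ▷ Y ≫ F.elemFam.obj ◁ k ≫ (paramFunctor α).obj
    rw [← whisker_exchange_assoc, inObj_paramFunctor_obj, ← Category.assoc]
    congr 1
    exact (congrArg _ (h _)).trans (MonoidalClosed.uncurry_natural_left _ _)

/-- The source of `V`-functoriality. Both transformations use the same parameter, which `graph`
passes on to the second functor; on components the identity is that evaluation turns `eMul` into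
successive evaluation. -/
lemma paramFunctor_mul (α : ParamNatTrans X F G) (β : ParamNatTrans X G H)
    (γ : ParamNatTrans X F H) (h : ∀ A, γ.app A = eMul (α.app A) (β.app A)) :
    paramFunctor γ = InternalCat.graph (paramFunctor α) ≫ paramFunctor β := by
  refine paramFunctor_ext (paramFunctor_comp _) ?_ fun A => ?_
  · rw [Category.assoc, paramFunctor_comp, paramProj, InternalCat.graph_proj_assoc,
      paramFunctor_comp]
  · rw [inObj_paramFunctor_obj]
    change _ = F.elemFam.inObj A ▷ X ≫ lift (paramFunctor α).obj (snd _ _) ≫ (paramFunctor β).obj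
    have e : F.elemFam.inObj A ▷ X ≫ lift (paramFunctor α).obj (snd _ _) =
        lift (paramEv α A) (snd _ _) ≫ G.elemFam.inObj A ▷ X := by
      rw [comp_lift, inObj_paramFunctor_obj]
      ext <;> simp
    rw [reassoc_of% e, inObj_paramFunctor_obj, ← Category.assoc]
    congr 1
    rw [lift_paramEv, paramEv, ← evalAt_snd_fst, paramEv, ← evalAt_snd_fst, ← evalAt_eMul,
      ← comp_eMul, h]

/-- Used to identify the underlying ordinary functor of the enriched construction with
`grothendieck`. -/
lemma paramFunctor_const (α : F ⟶ G) (γ : ParamNatTrans X F G)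
    (h : ∀ A, γ.app A = toUnit X ≫ VNatTrans.app α A) :
    paramFunctor γ = InternalCat.proj F.elemFam.total X ≫ (mapFam α).total := by
  refine paramFunctor_ext (paramFunctor_comp _) ?_ fun A => ?_
  · rw [Category.assoc]
    congr 1
    exact Over.w ((grothendieck V C).map α)
  · rw [inObj_paramFunctor_obj]
    change _ = F.elemFam.inObj A ▷ X ≫ fst _ _ ≫ (mapFam α).total.obj
    rw [whiskerRight_fst_assoc, FamFunctor.in_total_obj, ← Category.assoc]
    congr 1
    rw [paramEv, ← evalAt_snd_fst, h]
    refine Eq.trans ?_ (comp_evNat _ _ _).symm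
    simp

end VFunctor

end ParametrizedFunctors

/-! ### Generalized elements of the hom-objects of the three `V`-categories involved. -/

section Represented

variable {V : Type u} [Category.{v} V] [CartesianMonoidalCategory V]

lemma ParamHom.Rep.lift_mul {K : Type u₁} [Category.{v₁} K] {P : ParamHom.{v, u, u₁, v₁, t} V K}
    (R : P.Rep) {X : V} {a b c : K} (f : X ⟶ R.hom a b) (g : X ⟶ R.hom b c) :
    lift f g ≫ R.mul (fst _ _) (snd _ _) = R.mul f g := by
  rw [R.comp_mul, lift_fst, lift_snd]

namespace InternalCat

variable [HasPullbacks V] [MonoidalClosed V] {A B D : InternalCat V}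

/-- Generalized elements of hom-objects of the `V`-category of internal categories are parametrized
functors. -/
def functorEquiv {X : V} : (X ⟶ (A ⟶[V] B)) ≃ (A.prodConst X ⟶ B) := homObjEquiv A B

lemma functorEquiv_comp {X Y : V} (k : Y ⟶ X) (f : X ⟶ (A ⟶[V] B)) :
    functorEquiv (k ≫ f) = reindex A k ≫ functorEquiv f :=
  (homRep V).natural k f

lemma functorEquiv_eMul {X : V} (f : X ⟶ (A ⟶[V] B)) (g : X ⟶ (B ⟶[V] D)) :
    functorEquiv (eMul f g) = graph (functorEquiv f) ≫ functorEquiv g := by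
  have : eMul f g = (homRep V).mul f g := (homRep V).lift_mul f g
  rw [this]
  exact Equiv.apply_symm_apply _ _

lemma functorEquiv_eHomEquiv (F : A ⟶ B) :
    functorEquiv (eHomEquiv V F) = proj A _ ≫ F :=
  Equiv.apply_symm_apply _ _

lemma functorEquiv_comp_eHomEquiv {X : V} (k : X ⟶ 𝟙_ V) (F : A ⟶ B) :
    functorEquiv (k ≫ eHomEquiv V F) = proj A _ ≫ F := by
  rw [functorEquiv_comp, functorEquiv_eHomEquiv, reindex_proj_assoc]

end InternalCat

namespace OverEnriched

variable [HasPullbacks V] {K : Type u₁} [Category.{v₁} K] [EnrichedOrdinaryCategory V K] {b : K}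
  {P Q R : Over b}

variable (V P Q) in
/-- The inclusion of the hom-object of the slice category. -/
def forget : (P ⟶[V] Q) ⟶ (P.left ⟶[V] Q.left) := ι V P Q

lemma eMul_forget {X : V} (f : X ⟶ (P ⟶[V] Q)) (g : X ⟶ (Q ⟶[V] R)) :
    eMul f g ≫ forget V P R = eMul (f ≫ forget V P Q) (g ≫ forget V Q R) := by
  have : eMul f g = mul f g := by
    refine (comp_mul (lift f g) (fst (hom P Q) (hom Q R)) (snd _ _)).trans ?_
    congr 1
    · exact lift_fst _ _
    · exact lift_snd _ _
  rw [this]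
  exact mul_ι _ _

lemma eHomEquiv_forget (f : P ⟶ Q) : eHomEquiv V f ≫ forget V P Q = eHomEquiv V f.left :=
  mk_ι (eHomEquiv V f.left) (by
    rw [toUnit_unit, Category.id_comp, Category.id_comp, ← eHomEquiv_comp', Over.w])

lemma forget_condition {X : V} (f : X ⟶ (P ⟶[V] Q)) :
    eMul (f ≫ forget V P Q) (toUnit X ≫ eHomEquiv V Q.hom) = toUnit X ≫ eHomEquiv V P.hom :=
  condition f

/-- The hom-object of the slice is a fibre over a global element, so the other pullback projection
lands in the terminal object and carries no information. -/
lemma forget_ext {X : V} {f g : X ⟶ (P ⟶[V] Q)} (h : f ≫ forget V P Q = g ≫ forget V P Q) :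
    f = g :=
  hom_ext h

lemma exists_comp_forget_eq {X : V} (f : X ⟶ (P.left ⟶[V] Q.left))
    (h : eMul f (toUnit X ≫ eHomEquiv V Q.hom) = toUnit X ≫ eHomEquiv V P.hom) :
    ∃ g : X ⟶ (P ⟶[V] Q), g ≫ forget V P Q = f :=
  ⟨mk f h, mk_ι f h⟩

end OverEnriched

namespace VFunctor

variable {C : Type w} [EnrichedCategory V C] {D : Type u₁} [EnrichedCategory V D]
  [HasCoproducts.{w} V] [Extensive.{w} V] [BraidedCategory V] [MonoidalClosed V] [HasPullbacks V]
  {F G H : VFunctor V C D}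

/-- Generalized elements of hom-objects of the `V`-category of `V`-functors are parametrized
`V`-natural transformations. -/
def natEquiv {X : V} : (X ⟶ (F ⟶[V] G)) ≃ ParamNatTrans X F G := natObjEquiv F G

lemma natEquiv_comp_app {X Y : V} (k : Y ⟶ X) (f : X ⟶ (F ⟶[V] G)) (A : C) :
    (natEquiv (k ≫ f)).app A = k ≫ (natEquiv f).app A :=
  congrFun (congrArg ParamNatTrans.app ((natRep V C D).natural k f)) A

lemma natEquiv_eMul_app {X : V} (f : X ⟶ (F ⟶[V] G)) (g : X ⟶ (G ⟶[V] H)) (A : C) :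
    (natEquiv (eMul f g)).app A = eMul ((natEquiv f).app A) ((natEquiv g).app A) := by
  have : eMul f g = (natRep V C D).mul f g := (natRep V C D).lift_mul f g
  rw [this]
  exact congrFun (congrArg ParamNatTrans.app ((natRep V C D).equiv.apply_symm_apply _)) A

lemma natEquiv_eHomEquiv_app (α : F ⟶ G) (A : C) :
    (natEquiv (eHomEquiv V α)).app A = toUnit _ ≫ VNatTrans.app α A :=
  congrFun (congrArg ParamNatTrans.app ((natRep V C D).equiv.apply_symm_apply _)) A

end VFunctor

end Represented

/-! ### The Grothendieck construction on hom-objects. -/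

section Promotion

variable {V : Type u} [Category.{v} V] [CartesianMonoidalCategory V] [MonoidalClosed V]
  [HasPullbacks V] {C : Type w} [EnrichedCategory V C] [BraidedCategory V]
  [HasCoproducts.{w} V] [Extensive.{w} V]

open InternalCat

namespace OverEnriched

variable {B : InternalCat V} {P Q R : Over B} {X Y : V}

/-- The parametrized functor over `B` corresponding to a generalized element of a hom-object of the
slice category. -/
def toFunctor (g : X ⟶ (P ⟶[V] Q)) : P.left.prodConst X ⟶ Q.left :=
  functorEquiv (g ≫ forget V P Q)

lemma toFunctor_injective : Function.Injective (toFunctor : (X ⟶ (P ⟶[V] Q)) → _) :=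
  fun _ _ h => forget_ext (functorEquiv.injective h)

lemma toFunctor_comp_hom (g : X ⟶ (P ⟶[V] Q)) :
    toFunctor g ≫ Q.hom = InternalCat.proj P.left X ≫ P.hom := by
  have := congrArg functorEquiv (forget_condition g)
  rwa [functorEquiv_eMul, functorEquiv_comp_eHomEquiv, functorEquiv_comp_eHomEquiv,
    graph_proj_assoc] at this

/-- The fibre condition defining the hom-object transposes to the condition of lying over `B`. With
`toFunctor_injective` and `toFunctor_comp_hom`, elements of the hom-object are exactly the
parametrized functors over `B`. -/
lemma exists_toFunctor_eq (U : P.left.prodConst X ⟶ Q.left)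
    (hU : U ≫ Q.hom = InternalCat.proj P.left X ≫ P.hom) :
    ∃ g : X ⟶ (P ⟶[V] Q), toFunctor g = U := by
  obtain ⟨g, hg⟩ := exists_comp_forget_eq (functorEquiv.symm U) (by
    apply functorEquiv.injective
    rw [functorEquiv_eMul, functorEquiv_comp_eHomEquiv, functorEquiv_comp_eHomEquiv,
      graph_proj_assoc, Equiv.apply_symm_apply, hU])
  exact ⟨g, by rw [toFunctor, hg, Equiv.apply_symm_apply]⟩

lemma toFunctor_comp (k : Y ⟶ X) (g : X ⟶ (P ⟶[V] Q)) :
    toFunctor (k ≫ g) = InternalCat.reindex P.left k ≫ toFunctor g := by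
  rw [toFunctor, Category.assoc, functorEquiv_comp, toFunctor]

lemma toFunctor_eMul (f : X ⟶ (P ⟶[V] Q)) (g : X ⟶ (Q ⟶[V] R)) :
    toFunctor (eMul f g) = graph (toFunctor f) ≫ toFunctor g := by
  rw [toFunctor, eMul_forget, functorEquiv_eMul, toFunctor, toFunctor]

lemma toFunctor_eHomEquiv (f : P ⟶ Q) :
    toFunctor (eHomEquiv V f) = InternalCat.proj P.left _ ≫ f.left := by
  rw [toFunctor, eHomEquiv_forget, functorEquiv_eHomEquiv]

end OverEnriched

namespace VFunctor

open OverEnriched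

variable {F G H : VFunctor V Cᵒᵖ V} {X : V}

lemma exists_elemHom (g : X ⟶ (F ⟶[V] G)) :
    ∃ h : X ⟶ ((grothendieck V C).obj F ⟶[V] (grothendieck V C).obj G),
      toFunctor h = paramFunctor (natEquiv g) :=
  exists_toFunctor_eq _ (paramFunctor_comp _)

/-- The action of the Grothendieck construction on generalized elements of hom-objects. -/
def elemHom (g : X ⟶ (F ⟶[V] G)) : X ⟶ ((grothendieck V C).obj F ⟶[V] (grothendieck V C).obj G) :=
  (exists_elemHom g).choose

lemma toFunctor_elemHom (g : X ⟶ (F ⟶[V] G)) :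
    toFunctor (elemHom g) = paramFunctor (natEquiv g) := (exists_elemHom g).choose_spec

/-- By this naturality `elemHom` is composition with its value at the universal element `𝟙 (F ⟶[V]
G)`, which is therefore the action on hom-objects. -/
lemma comp_elemHom {Y : V} (k : Y ⟶ X) (g : X ⟶ (F ⟶[V] G)) :
    k ≫ elemHom g = elemHom (k ≫ g) := by
  apply toFunctor_injective
  rw [toFunctor_comp, toFunctor_elemHom, toFunctor_elemHom]
  exact (paramFunctor_res _ _ _ (natEquiv_comp_app k g)).symm

lemma elemHom_injective : Function.Injective (elemHom : (X ⟶ (F ⟶[V] G)) → _) := by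
  intro g g' h
  apply natEquiv.injective
  apply paramFunctor_injective
  rw [← toFunctor_elemHom, h, toFunctor_elemHom]

lemma elemHom_surjective : Function.Surjective (elemHom : (X ⟶ (F ⟶[V] G)) → _) := by
  intro h
  obtain ⟨α, hα⟩ := exists_paramFunctor_eq (toFunctor h) (toFunctor_comp_hom h)
  refine ⟨natEquiv.symm α, toFunctor_injective ?_⟩
  rw [toFunctor_elemHom, Equiv.apply_symm_apply, hα]

lemma elemHom_eMul (f : X ⟶ (F ⟶[V] G)) (g : X ⟶ (G ⟶[V] H)) :
    elemHom (eMul f g) = eMul (elemHom f) (elemHom g) := by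
  apply toFunctor_injective
  rw [toFunctor_eMul, toFunctor_elemHom, toFunctor_elemHom, toFunctor_elemHom]
  exact paramFunctor_mul _ _ _ (natEquiv_eMul_app f g)

lemma elemHom_eHomEquiv (α : F ⟶ G) :
    elemHom (eHomEquiv V α) = eHomEquiv V ((grothendieck V C).map α) := by
  apply toFunctor_injective
  rw [toFunctor_eHomEquiv, toFunctor_elemHom]
  exact paramFunctor_const _ _ (natEquiv_eHomEquiv_app α)

lemma comp_elemHom_id (g : X ⟶ (F ⟶[V] G)) : g ≫ elemHom (𝟙 _) = elemHom g := by
  rw [comp_elemHom, Category.comp_id]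

/-- The Yoneda lemma: a natural bijection on generalized elements comes from an isomorphism. A
preimage `k` of the identity is a one-sided inverse by naturality, and injectivity makes it
two-sided. -/
instance isIso_elemHom_id : IsIso (elemHom (𝟙 (F ⟶[V] G))) := by
  obtain ⟨k, hk⟩ := elemHom_surjective (F := F) (G := G) (𝟙 _)
  have h : k ≫ elemHom (𝟙 _) = 𝟙 _ := by rw [comp_elemHom_id, hk]
  refine ⟨k, elemHom_injective ?_, h⟩
  rw [← comp_elemHom, hk, Category.comp_id]

end VFunctor

variable (V C) in
/-- The Grothendieck construction, as a functor to discrete fibrations. -/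
abbrev grothendieckDFib : VFunctor V Cᵒᵖ V ⥤ DFib (intCat V C) :=
  (discreteFibrations (intCat V C)).lift (grothendieck V C)
    fun F => VFunctor.isDiscreteFibration_proj F

open VFunctor in
variable (V C) in
/-- The enrichment of the Grothendieck construction. -/
def grothendieckPromotion : Promotion (V := V) (grothendieckDFib V C) where
  map F G := elemHom (𝟙 (F ⟶[V] G))
  map_id F := by
    have := elemHom_eHomEquiv (𝟙 F)
    rw [(grothendieck V C).map_id, eHomEquiv_id, eHomEquiv_id] at this
    exact (comp_elemHom_id _).trans this
  map_comp F G H := by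
    -- Hom-objects and composition of discrete fibrations are those of the slice. Writing
    -- composition as `eMul` of the two projections reduces the claim to `elemHom_eMul`.
    refine (comp_elemHom_id _).trans (Eq.trans ?_ (tensorHom_comp_eComp (C := Over (intCat V C))
      (elemHom (𝟙 _)) (elemHom (𝟙 _))).symm)
    rw [comp_elemHom_id, comp_elemHom_id, ← elemHom_eMul, eMul_fst_snd]
  map_hom α := (comp_elemHom_id _).trans (elemHom_eHomEquiv α)

end Promotion

/-! ### `V`-functors from families of objects with a right action of `C`. -/

section Actions

variable {V : Type u} [Category.{v} V] [CartesianMonoidalCategory V] [MonoidalClosed V]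
  [HasPullbacks V] {C : Type w} [EnrichedCategory V C] [BraidedCategory V]

namespace VFunctor

/-- The transpose of an action on hom-objects. -/
def actionMap {Y : C → V} (act : ∀ A B : C, (A ⟶[V] B) ⊗ Y B ⟶ Y A) (A B : C) :
    (A ⟶[V] B) ⟶ (ihom (Y B)).obj (Y A) :=
  MonoidalClosed.curry (lift (snd _ _) (fst _ _) ≫ act A B)

lemma evalAt_comp_actionMap {Y : C → V} (act : ∀ A B : C, (A ⟶[V] B) ⊗ Y B ⟶ Y A) {A B : C}
    {X : V} (f : X ⟶ (A ⟶[V] B)) (x : X ⟶ Y B) :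
    evalAt (f ≫ actionMap act A B) x = lift f x ≫ act A B := by
  rw [actionMap, evalAt_comp_curry, ← Category.assoc, comp_lift, lift_fst, lift_snd]

variable (Y : C → V) (act : ∀ A B : C, (A ⟶[V] B) ⊗ Y B ⟶ Y A)

/-- The `V`-functor `Cᵒᵖ ⥤ V` given by a family of objects with a right action of `C`. -/
def ofAction
    (act_id : ∀ {X : V} (A : C) (x : X ⟶ Y A), lift (toUnit X ≫ eId V A) x ≫ act A A = x)
    (act_comp : ∀ {X : V} (A B D : C) (f : X ⟶ (A ⟶[V] B)) (g : X ⟶ (B ⟶[V] D)) (x : X ⟶ Y D),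
      lift (eMul f g) x ≫ act A D = lift f (lift g x ≫ act B D) ≫ act A B) :
    VFunctor V Cᵒᵖ V where
  obj A := Y A.unop
  map A B := actionMap act B.unop A.unop
  map_id A := by
    have h : eId V A.unop ≫ actionMap act A.unop A.unop = eId V (Y A.unop) := by
      apply evalAt_ext
      intro X k x
      rw [← Category.assoc, evalAt_comp_actionMap, toUnit_unique k (toUnit X), act_id]
      exact (evalAt_unit x).symm
    exact h
  map_comp A B D := by
    -- Evaluated at `x`, functoriality is the associativity of the action. The arguments appear as
    -- `eMul g f` because composition is taken in `C`, not in `Cᵒᵖ`.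
    have h {X : V} (f : X ⟶ (B.unop ⟶[V] A.unop)) (g : X ⟶ (D.unop ⟶[V] B.unop)) :
        eMul g f ≫ actionMap act D.unop A.unop = eMul (C := V) (a := Y A.unop) (b := Y B.unop)
          (c := Y D.unop) (f ≫ actionMap act B.unop A.unop) (g ≫ actionMap act D.unop B.unop) := by
      apply evalAt_ext
      intro Z k x
      rw [comp_eMul, evalAt_eMul, ← Category.assoc, comp_eMul, evalAt_comp_actionMap, act_comp,
        ← Category.assoc, evalAt_comp_actionMap, ← Category.assoc, evalAt_comp_actionMap]
    refine Eq.trans ?_ ((h (fst _ _) (snd _ _)).trans (tensorHom_comp_eComp (C := V)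
      (actionMap act B.unop A.unop) (actionMap act D.unop B.unop)).symm)
    -- What remains is that composition in `Cᵒᵖ` is composition in `C` with the factors swapped.
    refine congrArg (· ≫ actionMap act D.unop A.unop) ?_
    exact (eMul_fst_snd A B D).symm.trans (eMul_op _ _)

/-- Transposing twice returns the action, so the source map of the resulting category of elements is
the action one started from. -/
lemma ofAction_ev
    (act_id : ∀ {X : V} (A : C) (x : X ⟶ Y A), lift (toUnit X ≫ eId V A) x ≫ act A A = x)
    (act_comp : ∀ {X : V} (A B D : C) (f : X ⟶ (A ⟶[V] B)) (g : X ⟶ (B ⟶[V] D)) (x : X ⟶ Y D),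
      lift (eMul f g) x ≫ act A D = lift f (lift g x ≫ act B D) ≫ act A B) (A B : C) :
    (ofAction Y act act_id act_comp).ev A B = act A B := by
  have h := lift_ev (ofAction Y act act_id act_comp) (fst (A ⟶[V] B) (Y B)) (snd _ _)
  refine Eq.trans ?_ (h.trans ((evalAt_comp_actionMap act _ _).trans ?_))
  · exact (Category.id_comp _).symm.trans (congrArg (· ≫ _) lift_fst_snd.symm)
  · rw [lift_fst_snd, Category.id_comp]

end VFunctor

end Actions

/-! ### Every discrete fibration over `Int C` comes from a presheaf. -/

section EssentiallySurjective

variable {V : Type u} [Category.{v} V] [CartesianMonoidalCategory V] [MonoidalClosed V]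
  [HasPullbacks V] {C : Type w} [EnrichedCategory V C] [BraidedCategory V]
  [HasCoproducts.{w} V] [Extensive.{w} V]

namespace IsDiscreteFibration

variable {E : InternalCat V} {P : E ⟶ (intFam V C).total} (hP : IsDiscreteFibration P)
  {Y : C → V} (e : ∐ Y ≅ E.obj)
  (he : ∀ A, Sigma.ι Y A ≫ e.hom ≫ P.obj = toUnit _ ≫ (intFam V C).inObj A)

/-- The inclusion of a fibre. -/
abbrev fibreι (A : C) : Y A ⟶ E.obj := Sigma.ι Y A ≫ e.hom

/-- The morphisms of a discrete fibration over `Int C` with target in a given fibre. -/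
def cartesianLift (A B : C) : (A ⟶[V] B) ⊗ Y B ⟶ E.mor :=
  IsPullback.lift hP (snd _ _ ≫ fibreι e B) (fst _ _ ≫ (intFam V C).inMor A B) (by
    rw [Category.assoc, Category.assoc, he, Category.assoc, FamCat.in_tgt, ← Category.assoc,
      ← Category.assoc]
    exact congrArg (· ≫ _) (toUnit_unique _ _))

lemma cartesianLift_tgt (A B : C) : hP.cartesianLift e he A B ≫ E.tgt = snd _ _ ≫ fibreι e B :=
  IsPullback.lift_fst hP _ _ _

lemma cartesianLift_mor (A B : C) :
    hP.cartesianLift e he A B ≫ P.mor = fst _ _ ≫ (intFam V C).inMor A B :=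
  IsPullback.lift_snd hP _ _ _

lemma lift_cartesianLift_tgt {X : V} {A B : C} (f : X ⟶ (A ⟶[V] B)) (x : X ⟶ Y B) :
    lift f x ≫ hP.cartesianLift e he A B ≫ E.tgt = x ≫ fibreι e B := by
  rw [cartesianLift_tgt, lift_snd_assoc]

lemma lift_cartesianLift_mor {X : V} {A B : C} (f : X ⟶ (A ⟶[V] B)) (x : X ⟶ Y B) :
    lift f x ≫ hP.cartesianLift e he A B ≫ P.mor = f ≫ (intFam V C).inMor A B := by
  rw [cartesianLift_mor, lift_fst_assoc]

/-- The lift lies over `C(A, B)`, so its source lies over the summand of `∐ 1` indexed by `A` and,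
by extensivity, factors through the fibre `Y A`. -/
lemma exists_fibre_action (A B : C) : ∃ act : (A ⟶[V] B) ⊗ Y B ⟶ Y A,
    act ≫ fibreι e A = hP.cartesianLift e he A B ≫ E.src := by
  -- Under `e`, the map `P.obj` is the coproduct of the maps `Y A → 1`, the form in which factoring
  -- through a summand is available.
  have hm : Limits.Sigma.map (fun A => toUnit (Y A)) = e.hom ≫ P.obj := by
    apply Limits.Sigma.hom_ext
    intro A
    exact (Limits.Sigma.ι_map _ _).trans (he A).symm
  obtain ⟨act, h⟩ := exists_lift_summand (fun A => toUnit (Y A))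
    (hP.cartesianLift e he A B ≫ E.src ≫ e.inv) A (toUnit _) (by
      refine (congrArg _ hm).trans ?_
      change (_ ≫ _ ≫ e.inv) ≫ e.hom ≫ P.obj = toUnit _ ≫ (intFam V C).inObj A
      rw [Category.assoc, Category.assoc, e.inv_hom_id_assoc, ← P.src]
      rw [← Category.assoc, cartesianLift_mor, Category.assoc, FamCat.in_src, ← Category.assoc]
      exact congrArg (· ≫ _) (toUnit_unique _ _))
  exact ⟨act, by rw [fibreι, ← Category.assoc, h]; simp⟩

/-- The action of `C` on the fibres of a discrete fibration over `Int C`. -/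
def fibreAction (A B : C) : (A ⟶[V] B) ⊗ Y B ⟶ Y A := (hP.exists_fibre_action e he A B).choose

lemma fibreAction_fibreι (A B : C) :
    hP.fibreAction e he A B ≫ fibreι e A = hP.cartesianLift e he A B ≫ E.src :=
  (hP.exists_fibre_action e he A B).choose_spec

/-- The identity arrow at `x` has target `x` and lies over the identity of `A`. By uniqueness it is
the lift, and its source is `x`. -/
lemma fibreAction_id {X : V} (A : C) (x : X ⟶ Y A) :
    lift (toUnit X ≫ eId V A) x ≫ hP.fibreAction e he A A = x := by
  rw [← cancel_mono (fibreι e A), Category.assoc, fibreAction_fibreι]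
  have : lift (toUnit X ≫ eId V A) x ≫ hP.cartesianLift e he A A = x ≫ fibreι e A ≫ E.one := by
    apply IsPullback.hom_ext hP
    · rw [Category.assoc, lift_cartesianLift_tgt]
      simp
    · rw [Category.assoc, lift_cartesianLift_mor, Category.assoc, Category.assoc, Category.assoc,
        P.one, Category.assoc, reassoc_of% (he A), FamCat.in_one, ← Category.assoc,
        ← Category.assoc]
      simp
  rw [reassoc_of% this, E.one_src, Category.comp_id]

/-- The lift of `g` at `x` starts where the lift of `f` must end, and their composite lies over the
composite of `f` and `g` with target `x`. By uniqueness it is the lift of that composite; now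
compare sources. -/
lemma fibreAction_comp {X : V} (A B D : C) (f : X ⟶ (A ⟶[V] B)) (g : X ⟶ (B ⟶[V] D))
    (x : X ⟶ Y D) :
    lift (eMul f g) x ≫ hP.fibreAction e he A D =
      lift f (lift g x ≫ hP.fibreAction e he B D) ≫ hP.fibreAction e he A B := by
  have h : (lift f (lift g x ≫ hP.fibreAction e he B D) ≫ hP.cartesianLift e he A B) ≫ E.tgt =
      (lift g x ≫ hP.cartesianLift e he B D) ≫ E.src := by
    rw [Category.assoc, lift_cartesianLift_tgt, Category.assoc, fibreAction_fibreι, Category.assoc]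
  have hfg : (f ≫ (intFam V C).inMor A B) ≫ (intFam V C).tgt =
      (g ≫ (intFam V C).inMor B D) ≫ (intFam V C).src := by
    rw [Category.assoc, Category.assoc, FamCat.in_tgt, FamCat.in_src, ← Category.assoc,
      ← Category.assoc]
    exact congrArg (· ≫ _) (toUnit_unique _ _)
  have hm : lift (eMul f g) x ≫ hP.cartesianLift e he A D = E.mul _ _ h := by
    apply IsPullback.hom_ext hP
    · rw [Category.assoc, lift_cartesianLift_tgt, InternalCat.mul_tgt, Category.assoc,
        lift_cartesianLift_tgt]
    · rw [Category.assoc, lift_cartesianLift_mor, P.mul_mor]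
      refine Eq.trans ?_ (InternalCat.mul_congr (h := hfg)
        ((Category.assoc _ _ _).trans (hP.lift_cartesianLift_mor e he _ _)).symm
        ((Category.assoc _ _ _).trans (hP.lift_cartesianLift_mor e he _ _)).symm)
      -- Composition in `Int C` of arrows from the summands `(A, B)` and `(B, D)` is composition in
      -- `C`.
      refine Eq.trans ?_ ((intFam V C).lift_in_comp f g (toUnit_unique _ _)).symm
      rw [← Category.assoc, comp_eMul, pullback.lift_fst, pullback.lift_snd]
  rw [← cancel_mono (fibreι e A), Category.assoc, Category.assoc, fibreAction_fibreι,
    fibreAction_fibreι, reassoc_of% hm, InternalCat.mul_src, Category.assoc]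

/-- The `V`-functor of fibres of a discrete fibration over `Int C`. -/
def fibres : VFunctor V Cᵒᵖ V :=
  .ofAction Y (hP.fibreAction e he) (hP.fibreAction_id e he) (hP.fibreAction_comp e he)

/-- The comparison from the category of elements of the functor of fibres, on objects. -/
def fibresObj : (hP.fibres e he).elemFam.obj ⟶ E.obj := e.hom

instance : IsIso (hP.fibresObj e he) := inferInstanceAs (IsIso e.hom)

/-- The comparison from the category of elements of the functor of fibres, on summands of the object
of morphisms. -/
def fibresLift (A B : C) : (A ⟶[V] B) ⊗ (hP.fibres e he).obj (.op B) ⟶ E.mor :=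
  hP.cartesianLift e he A B

lemma fibresLift_tgt (A B : C) : hP.fibresLift e he A B ≫ E.tgt =
    snd _ _ ≫ (hP.fibres e he).elemFam.inObj B ≫ hP.fibresObj e he :=
  hP.cartesianLift_tgt e he A B

lemma fibresLift_mor (A B : C) :
    hP.fibresLift e he A B ≫ P.mor = fst _ _ ≫ (intFam V C).inMor A B :=
  hP.cartesianLift_mor e he A B

lemma fibresLift_src (A B : C) : hP.fibresLift e he A B ≫ E.src =
    (hP.fibres e he).ev A B ≫ (hP.fibres e he).elemFam.inObj A ≫ hP.fibresObj e he := by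
  have h : (hP.fibres e he).ev A B = hP.fibreAction e he A B := VFunctor.ofAction_ev _ _ _ _ _ _
  rw [h]
  exact (hP.fibreAction_fibreι e he A B).symm

lemma fibresObj_comp_obj : hP.fibresObj e he ≫ P.obj = (hP.fibres e he).projFam.total.obj := by
  apply FamCat.obj_ext
  intro A
  rw [FamFunctor.in_total_obj]
  exact he A

/-- The comparison from the category of elements of the functor of fibres. -/
def fibresComparison : (hP.fibres e he).elemFam.total ⟶ E :=
  hP.liftFunctor (hP.fibres e he).projFam.total (hP.fibresObj e he) (hP.fibresObj_comp_obj e he) (by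
    apply FamCat.mor_ext
    intro A B
    -- The action on morphisms forced by the discrete fibration restricts on each summand to the
    -- chosen lift, whose source is the evaluation map of the functor of fibres. This yields
    -- compatibility with sources.
    have h : (hP.fibres e he).elemFam.inMor A B ≫ hP.liftMor (hP.fibres e he).projFam.total
        (hP.fibresObj e he) (hP.fibresObj_comp_obj e he) = hP.fibresLift e he A B := by
      apply IsPullback.hom_ext hP
      · rw [Category.assoc, liftMor_tgt, fibresLift_tgt, FamCat.in_tgt_assoc]
      · rw [Category.assoc, liftMor_mor, fibresLift_mor, FamFunctor.in_total_mor]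
        rfl
    rw [← Category.assoc, h, fibresLift_src, FamCat.in_src_assoc])

lemma fibresComparison_comp :
    hP.fibresComparison e he ≫ P = (hP.fibres e he).projFam.total :=
  liftFunctor_comp _ _ _ _ _

/-- On objects the comparison is the decomposition isomorphism `e`, and between discrete fibrations
invertibility on objects suffices. -/
lemma isIso_fibresComparison : IsIso (hP.fibresComparison e he) := by
  have : IsIso (hP.fibresComparison e he).obj := inferInstanceAs (IsIso (hP.fibresObj e he))
  exact (hP.fibres e he).isDiscreteFibration_proj.isIso_of_isIso_obj hP _
    (hP.fibresComparison_comp e he)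

/-- Every discrete fibration over `Int C` is a category of elements. -/
lemma exists_iso_elemFam_total (hP : IsDiscreteFibration P) :
    ∃ (F : VFunctor V Cᵒᵖ V) (i : F.elemFam.total ≅ E), i.hom ≫ P = F.projFam.total := by
  -- Extensivity applied to `P.obj : E.obj ⟶ ∐ 1` produces the fibres; the maps `y A` go to the
  -- terminal object and can be replaced by `toUnit`.
  obtain ⟨Y, y, e, he⟩ := exists_decomp (fun _ : C => 𝟙_ V) P.obj
  have he' (A : C) : Sigma.ι Y A ≫ e.hom ≫ P.obj = toUnit _ ≫ (intFam V C).inObj A :=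
    (he A).trans (congrArg (· ≫ _) (toUnit_unique _ _))
  have := hP.isIso_fibresComparison e he'
  exact ⟨hP.fibres e he', asIso (hP.fibresComparison e he'), hP.fibresComparison_comp e he'⟩

end IsDiscreteFibration

instance grothendieckDFib_essSurj : (grothendieckDFib V C).EssSurj where
  mem_essImage P := by
    obtain ⟨F, i, hi⟩ := IsDiscreteFibration.exists_iso_elemFam_total (V := V) (C := C) P.property
    exact ⟨F, ⟨ObjectProperty.isoMk _ (Over.isoMk i hi)⟩⟩

end EssentiallySurjective

/-! ### From isomorphisms on hom-objects to equivalences. -/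

section Equivalence

variable {V : Type u} [Category.{v} V] [CartesianMonoidalCategory V] [HasPullbacks V]

section

variable {C : Type u₁} [Category.{v₁} C] [EnrichedOrdinaryCategory V C]
  {D : Type u₂} [Category.{t} D] [EnrichedOrdinaryCategory V D] {Φ : C ⥤ D}

/-- A functor with a promotion which is invertible on hom-objects is fully faithful. -/
def Promotion.fullyFaithful (P : Promotion (V := V) Φ) [∀ A B, IsIso (P.map A B)] :
    Φ.FullyFaithful where
  preimage {A B} g := (eHomEquiv V).symm (eHomEquiv V g ≫ inv (P.map A B))
  map_preimage {A B} g := by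
    apply (eHomEquiv V).injective
    rw [← P.map_hom, Equiv.apply_symm_apply, Category.assoc, IsIso.inv_hom_id, Category.comp_id]
  preimage_map {A B} f := by
    apply (eHomEquiv V).injective
    rw [← P.map_hom, Equiv.apply_symm_apply, Category.assoc, IsIso.hom_inv_id, Category.comp_id]

/-- A promotion of an essentially surjective functor which is invertible on hom-objects is an
equivalence of `V`-categories. -/
lemma Promotion.isVEquivalence (P : Promotion (V := V) Φ) [∀ A B, IsIso (P.map A B)]
    [Φ.EssSurj] : P.toVFunctor.IsVEquivalence := by
  have (A B : C) : IsIso (P.toVFunctor.map A B) := inferInstanceAs (IsIso (P.map A B))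
  have h {a b : D} (i : a ≅ b) : eMul (eHomEquiv V i.hom) (eHomEquiv V i.inv) = eId V a := by
    rw [← OverEnriched.eHomEquiv_comp', i.hom_inv_id, eHomEquiv_id]
  -- Ordinary essential surjectivity suffices: ordinary isomorphisms name mutually inverse global
  -- elements of the hom-objects.
  refine P.toVFunctor.isVEquivalence_of_isIso_map Φ.objPreimage
    (x := fun d => eHomEquiv V (Φ.objObjPreimageIso d).hom)
    (y := fun d => eHomEquiv V (Φ.objObjPreimageIso d).inv) (fun d => ?_) (fun d => ?_)
  · exact h (Φ.objObjPreimageIso d)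
  · exact h (Φ.objObjPreimageIso d).symm

end

variable [MonoidalClosed V] {C : Type w} [EnrichedCategory V C]
  [BraidedCategory V] [HasCoproducts.{w} V] [Extensive.{w} V]

instance isIso_grothendieckPromotion_map (F G : VFunctor V Cᵒᵖ V) :
    IsIso ((grothendieckPromotion V C).map F G) :=
  VFunctor.isIso_elemHom_id

end Equivalence

end IntGroth

end

theorem theoremA {V : Type u} [Category.{v} V] [CartesianMonoidalCategory V] [BraidedCategory V]
    [MonoidalClosed V] [HasPullbacks V] [HasCoproducts.{w} V] [Extensive.{w} V]
    {C : Type w} [EnrichedCategory V C] :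
    ∃ h : ∀ F : VFunctor V Cᵒᵖ V, discreteFibrations (intCat V C) ((grothendieck V C).obj F),
      let Φ : VFunctor V Cᵒᵖ V ⥤ DFib (intCat V C) :=
        (discreteFibrations (intCat V C)).lift (grothendieck V C) h
      Φ.IsEquivalence ∧ ∃ E : Promotion (V := V) Φ, E.toVFunctor.IsVEquivalence := by
  -- Ordinary full faithfulness is invertibility on hom-objects read on global elements, so the two
  -- claimed equivalences rest on the same isomorphisms.
  have hF := (grothendieckPromotion V C).fullyFaithful
  exact ⟨fun F => VFunctor.isDiscreteFibration_proj F,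
    { faithful := hF.faithful, full := hF.full, essSurj := grothendieckDFib_essSurj },
    grothendieckPromotion V C, (grothendieckPromotion V C).isVEquivalence⟩
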